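/- We work over $\mathbb{C}$; let $n\geq 0$ and $s\geq 0$ be integers and $V=\mathbb{C}^{2n}$. Let $\mathcal{LG}(n,2n)\subset\mathbb{P}(V_{\omega_n})$ be the Lagrangian Grassmannian, that is, the variety of $n$-dimensional subspaces of $V$ that are isotropic for the symplectic form $\left(\begin{smallmatrix}0&I_n\\-I_n&0\end{smallmatrix}\right)$, in its Plücker embedding, where $\mathbb{P}(V_{\omega_n})$ is its linear span in $\mathbb{P}(\bigwedge^nV)$. Let $\mathcal{S}_n$ be the Spinor variety, that is, the connected component containing $\langle e_1,\dots,e_n\rangle$ of the variety of $n$-dimensional subspaces of $V$ that are isotropic for the quadratic form $\left(\begin{smallmatrix}0&I_n\\I_n&0\end{smallmatrix}\right)$. (It consists of the maximal isotropic subspaces $W$ with $\dim (W\cap\langle e_1,\dots,e_n\rangle)\equiv n \bmod 2$.) It is embedded in $\mathbb{P}(\bigwedge^nV_+)$, its linear span in the Plücker embedding, and in the projectivized half-spin representation $\mathbb{P}(\Delta)=\mathbb{P}^{2^{n-1}-1}$ by the Spinor embedding, which sends $W$ to the line of spinors annihilated by $W$; on the subspaces spanned by the columns of $\left(\begin{smallmatrix}I_n\\B\end{smallmatrix}\right)$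 with $B$ skew-symmetric, it is given by $B\mapsto[\operatorname{Pf}(B_I)]_I$, where $I$ runs over the subsets of $\{1,\dots,n\}$ of even cardinality and $B_I$ is the principal submatrix on $I$. For a smooth point $p$ of an irreducible variety $X\subset\mathbb{P}^N$ and a local parametrization $\phi$ of $X$ with values in an affine chart $\mathbb{C}^N$ and with $\phi(0)=p$, the $s$-osculating space $T_p^sX$ is the projective closure of the affine subspace of $\mathbb{C}^N$ through $p$ whose direction is generated by the partial derivatives of $\phi$ at $0$ of orders $1,\dots,s$. Let $\Pi_{T_p^s}$ denote the linear projection of $X$ with center $T_p^sX$. Birational means birational onto the closure of the image. Then the following hold. 1. For $X=\mathcal{LG}(n,2n)\subset\mathbb{P}(V_{\omega_n})$: if $0\leq s\leq n-2$, then $\Pi_{T_p^s}$ is birational for every $p\in X$. 2. For $X=\mathcal{S}_n\subset\mathbb{P}(\bigwedge^nV_+)$: if $0\leq s\leq 2\lfloor\frac n2\rfloor-2$, then $\Pi_{T_p^s}$ is birational for every $p\in X$. 3. For $X=\mathcal{S}_n\subset\mathbb{P}(\Delta)$: if $0\leq s\leq\lfloor\frac n2\rfloor-2$, then $\Pi_{T_p^s}$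 is birational for every $p\in X$. -/

import Mathlib

open scoped LinearAlgebra.Projectivization

noncomputable section

namespace OscProj

/-! ### Projective sets, osculating spaces and linear projections

Projective space with homogeneous coordinates indexed by a finite type `ι` is `ℙ ℂ (ι → ℂ)`. -/

section General

variable {ι : Type} [Fintype ι]

/-- The vector subspace whose projectivization is the linear span of `X`. -/
def linearSpan (X : Set (ℙ ℂ (ι → ℂ))) : Submodule ℂ (ι → ℂ) :=
  Submodule.span ℂ {x | ∃ h : x ≠ 0, Projectivization.mk ℂ x h ∈ X}

/-- Zariski closed subsets of projective space: common zero loci of homogeneous polynomials. -/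
def IsZariskiClosed (Z : Set (ℙ ℂ (ι → ℂ))) : Prop :=
  ∃ F : Set (MvPolynomial ι ℂ), (∀ f ∈ F, ∃ d : ℕ, f.IsHomogeneous d) ∧
    Z = {p | ∀ f ∈ F, MvPolynomial.eval p.rep f = 0}

/-- The part of `X` in the affine chart `{ℓ ≠ 0}` of projective space, the chart being
identified with the affine hyperplane `{x | ℓ x = 1}` of the space of homogeneous coordinates. -/
def affinePart (X : Set (ℙ ℂ (ι → ℂ))) (ℓ : (ι → ℂ) →ₗ[ℂ] ℂ) : Set (ι → ℂ) :=
  {x | ℓ x = 1 ∧ ∃ h : x ≠ 0, Projectivization.mk ℂ x h ∈ X}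

/-- `φ : U → {ℓ = 1}`, with `U` an open neighbourhood of `0` in `ℂ^m`, is a (holomorphic) local
parametrization of `X` around the point `p`: a holomorphic immersion which is a homeomorphism
onto an open subset of the affine part of `X`, and which sends `0` to `p`. -/
structure IsLocalParametrization (X : Set (ℙ ℂ (ι → ℂ))) (p : ℙ ℂ (ι → ℂ)) {m : ℕ}
    (ℓ : (ι → ℂ) →ₗ[ℂ] ℂ) (U : Set (Fin m → ℂ)) (φ : (Fin m → ℂ) → (ι → ℂ)) : Prop where
  isOpen : IsOpen U
  zero_mem : 0 ∈ U
  holomorphic : AnalyticOnNhd ℂ φ U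
  mapsTo : Set.MapsTo φ U (affinePart X ℓ)
  isOpenEmbedding : Topology.IsOpenEmbedding mapsTo.restrict
  immersion : ∀ t ∈ U, Function.Injective (fderiv ℂ φ t)
  base : ∃ h : φ 0 ≠ 0, Projectivization.mk ℂ (φ 0) h = p

/-- The mixed partial derivative `∂^k φ / ∂t_{i 0} ⋯ ∂t_{i (k-1)}` at the origin. -/
def partialDeriv {m k : ℕ} (φ : (Fin m → ℂ) → (ι → ℂ)) (i : Fin k → Fin m) : ι → ℂ :=
  iteratedFDeriv ℂ k φ 0 (fun j => Pi.single (i j) 1)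

/-- `T` is (the vector space whose projectivization is) the `s`-osculating space of `X` at `p`:
for a local parametrization `φ` of `X` around `p`, it is the projective closure of the affine
subspace through `φ 0` whose direction is spanned by the partial derivatives of `φ` at `0` of
orders `1, …, s`, that is, the span of `φ 0` (the derivative of order `0`) and of these vectors. -/
def IsOsculatingSpace (X : Set (ℙ ℂ (ι → ℂ))) (p : ℙ ℂ (ι → ℂ)) (s : ℕ)
    (T : Submodule ℂ (ι → ℂ)) : Prop :=
  ∃ (m : ℕ) (ℓ : (ι → ℂ) →ₗ[ℂ] ℂ) (U : Set (Fin m → ℂ)) (φ : (Fin m → ℂ) → (ι → ℂ)),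
    IsLocalParametrization X p ℓ U φ ∧
    T = Submodule.span ℂ {x | ∃ k ≤ s, ∃ i : Fin k → Fin m, x = partialDeriv φ i}

/-- Let `X` be an irreducible projective variety contained in `ℙ(M)`, and let `L` be a linear map
on `M`. The rational map `[x] ↦ [L x]` on `X` is birational onto (the closure of) its image: on a
nonempty Zariski open subset `X \ Z` of `X` it is defined and it is inverted by a rational map
`y ↦ [G y]` given by homogeneous polynomials `G` of the same degree. -/
def IsBirationalOntoImage (M : Submodule ℂ (ι → ℂ)) (X : Set (ℙ ℂ (ι → ℂ))) {k : ℕ}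
    (L : M →ₗ[ℂ] (Fin k → ℂ)) : Prop :=
  ∃ Z : Set (ℙ ℂ (ι → ℂ)), IsZariskiClosed Z ∧ (X \ Z).Nonempty ∧
    ∃ (d : ℕ) (G : ι → MvPolynomial (Fin k) ℂ), (∀ i, (G i).IsHomogeneous d) ∧
      ∀ p ∈ X \ Z, ∃ hp : p.rep ∈ M, L ⟨p.rep, hp⟩ ≠ 0 ∧
        ∃ h : (fun i => MvPolynomial.eval (L ⟨p.rep, hp⟩) (G i)) ≠ 0,
          Projectivization.mk ℂ (fun i => MvPolynomial.eval (L ⟨p.rep, hp⟩) (G i)) h = p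

/-- The linear projection of `X ⊆ ℙ(M)` with center `ℙ(T)`, `T ≤ M`, is birational onto its image.
The projection is `[x] ↦ [L x]` for a surjective linear map `L : M → ℂ^k` with kernel `T`. -/
def ProjectionIsBirational (M : Submodule ℂ (ι → ℂ)) (X : Set (ℙ ℂ (ι → ℂ)))
    (T : Submodule ℂ (ι → ℂ)) : Prop :=
  T ≤ M ∧ ∀ (k : ℕ) (L : M →ₗ[ℂ] (Fin k → ℂ)), Function.Surjective L →
    LinearMap.ker L = T.submoduleOf M → IsBirationalOntoImage M X L

end General

/-! ### The Plücker embedding, Lagrangian Grassmannians and Spinor varieties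

`V = ℂ^{2n}` is `Fin (n + n) → ℂ`; the first `n` coordinates are indexed by `Fin.castAdd n i`, the
last `n` by `Fin.natAdd n i`. -/

/-- Indices of Plücker coordinates: increasing sequences of `n` elements of `{1, …, 2n}`. -/
abbrev PluckerIndex (n : ℕ) : Type := Fin n ↪o Fin (n + n)

/-- The coordinates of `w_1 ∧ ⋯ ∧ w_n`: maximal minors of the matrix with columns `w_j`. -/
def pluckerVector {n : ℕ} (w : Fin n → (Fin (n + n) → ℂ)) : PluckerIndex n → ℂ :=
  fun J => Matrix.det (Matrix.of fun i j => w j (J i))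

/-- The image under the Plücker embedding of a set of `n`-dimensional subspaces of `ℂ^{2n}`. -/
def pluckerImage {n : ℕ} (S : Set (Submodule ℂ (Fin (n + n) → ℂ))) :
    Set (ℙ ℂ (PluckerIndex n → ℂ)) :=
  {p | ∃ W ∈ S, ∃ b : Module.Basis (Fin n) ℂ W,
    ∃ h : pluckerVector (fun j => (b j : Fin (n + n) → ℂ)) ≠ 0,
      Projectivization.mk ℂ (pluckerVector (fun j => (b j : Fin (n + n) → ℂ))) h = p}

/-- The symplectic form with matrix `(0, I; -I, 0)`. -/
def sympForm {n : ℕ} (v w : Fin (n + n) → ℂ) : ℂ :=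
  ∑ i : Fin n, (v (Fin.castAdd n i) * w (Fin.natAdd n i) - v (Fin.natAdd n i) * w (Fin.castAdd n i))

/-- The symmetric form with matrix `(0, I; I, 0)`. -/
def quadForm {n : ℕ} (v w : Fin (n + n) → ℂ) : ℂ :=
  ∑ i : Fin n, (v (Fin.castAdd n i) * w (Fin.natAdd n i) + v (Fin.natAdd n i) * w (Fin.castAdd n i))

/-- Lagrangian subspaces of `ℂ^{2n}`. -/
def lagrangianSubspaces (n : ℕ) : Set (Submodule ℂ (Fin (n + n) → ℂ)) :=
  {W | Module.finrank ℂ W = n ∧ ∀ v ∈ W, ∀ w ∈ W, sympForm v w = 0}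

/-- The coordinate subspace spanned by the first `n` basis vectors. -/
def baseSubspace (n : ℕ) : Submodule ℂ (Fin (n + n) → ℂ) :=
  Submodule.span ℂ (Set.range fun i : Fin n => Pi.single (Fin.castAdd n i) (1 : ℂ))

/-- The family (connected component) containing `baseSubspace n` of the maximal isotropic subspaces
of `ℂ^{2n}`: two maximal isotropic subspaces belong to the same family if and only if the dimension
of their intersection is congruent to `n` modulo `2`. -/
def spinorSubspaces (n : ℕ) : Set (Submodule ℂ (Fin (n + n) → ℂ)) :=
  {W | Module.finrank ℂ W = n ∧ (∀ v ∈ W, ∀ w ∈ W, quadForm v w = 0) ∧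
    Module.finrank ℂ (W ⊓ baseSubspace n : Submodule ℂ (Fin (n + n) → ℂ)) ≡ n [MOD 2]}

/-- The Lagrangian Grassmannian in its Plücker embedding; its linear span is `ℙ(V_{ω_n})`. -/
def lagrangianGrassmannian (n : ℕ) : Set (ℙ ℂ (PluckerIndex n → ℂ)) :=
  pluckerImage (lagrangianSubspaces n)

/-- The Spinor variety in its Plücker embedding; its linear span is `ℙ(⋀ⁿ V₊)`. -/
def spinorPlucker (n : ℕ) : Set (ℙ ℂ (PluckerIndex n → ℂ)) :=
  pluckerImage (spinorSubspaces n)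

/-! ### The Spinor embedding

The spin representation is the exterior algebra on the span of the last `n` basis vectors
`f_1, …, f_n` of `V`, with basis `f_I`, `I ⊆ {1, …, n}`; `f_i` acts by `f_i ∧ ·` and the basis
vector `e_i` (one of the first `n`) by contraction. -/

/-- Clifford multiplication of a vector of `ℂ^{2n}` on the spin representation. -/
def cliffordMul {n : ℕ} (v : Fin (n + n) → ℂ) (ψ : Finset (Fin n) → ℂ) : Finset (Fin n) → ℂ :=
  fun I => ∑ i : Fin n, (-1 : ℂ) ^ (I.filter (· < i)).card *
    (if i ∈ I then v (Fin.natAdd n i) * ψ (I.erase i) else v (Fin.castAdd n i) * ψ (insert i I))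

/-- Indices of the coordinates of the half-spin representation `Δ`: subsets of even cardinality. -/
abbrev EvenSubset (n : ℕ) : Type := {I : Finset (Fin n) // Even I.card}

/-- The inclusion of the half-spin representation `Δ` in the spin representation. -/
def ofHalfSpin {n : ℕ} (ψ : EvenSubset n → ℂ) : Finset (Fin n) → ℂ :=
  fun I => if h : Even I.card then ψ ⟨I, h⟩ else 0

/-- The Spinor variety in `ℙ(Δ)`, the variety of even pure spinors: the embedding sends a maximal
isotropic subspace `W` to the line of spinors annihilated by `W`. On the subspaces spanned by the
columns of `(I; B)`, `B` skew-symmetric, it is `B ↦ [Pf(B_I)]_I`. -/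
def spinorVariety (n : ℕ) : Set (ℙ ℂ (EvenSubset n → ℂ)) :=
  {p | ∃ W ∈ spinorSubspaces n, ∀ w ∈ W, cliffordMul w (ofHalfSpin p.rep) = 0}

end OscProj

end

noncomputable section

namespace OscProj

open Filter Topology
open scoped symmDiff
open scoped LinearAlgebra.Projectivization

/-! ### Orders of vanishing of analytic functions -/

section Vanishing

variable {E : Type*} [NormedAddCommGroup E] [NormedSpace ℂ E]

/-! A linear form `y` contains the osculating space in its kernel as soon as `y ∘ φ` vanishes to
order `s + 1` at the origin for every analytic family `φ` in the variety through the point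
(`IsOsculatingSpace.le_ker`). Such a form factors through the projection. Birationality therefore
follows once enough forms of this kind are found to recover a general point by homogeneous
polynomials (`ProjectionIsBirational.of_recovery`). In all three cases these forms are the
coordinates of order at most one, up to scale, in an affine chart centred far from the point.

Plücker embeddings. The form `det (ℓ i (w j))` vanishes at a subspace `W` to order at least the
number of `ℓ i` that kill `W` (`vanishesToOrder_pluckerFunctional`). A coordinate isotropic subspace
`E` transverse to `W` exists (`exists_coordSubspace_inf_eq_bot`), so `W` has `n` graph equations.
Take these equations as the `ℓ i`, and also replace one of them by an arbitrary coordinate: at least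
`n - 1` equations survive, and the resulting determinants are the homogeneous coordinates of the
chart of complements to `W`, from which Cramer's rule recovers the subspace
(`pluckerVector_recovery`). The chart has to meet the variety, which holds if `E` is in the family.
For the Spinor variety with `n` odd, `E` is in the opposite family; a neighbour of `E` is used, at
the cost of one equation.

Spinor embedding. The coordinates of a pure spinor satisfy Pfaffian-type expansions
(`IsPure.mul_eq_sum`), used twice. If `ψ K ≠ 0` at the base point and the coordinates at distance
two from `K` have been made zero there (`exists_normalizing_symmetry`), a coordinate at distance `r`
from `K` vanishes to order `r / 2` (`vanishesToOrder_of_isPure`). Where `ψ J ≠ 0`, all coordinates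
are determined by those at `J` and at distance two from `J` (`exists_recovery_polynomial`). It
remains to choose `J` far from `K` (`exists_far_index`). -/

/-- `f` is analytic at the origin and its derivatives of order less than `k` vanish there. -/
def VanishesToOrder (f : E → ℂ) (k : ℕ) : Prop :=
  AnalyticAt ℂ f 0 ∧ ∀ j < k, iteratedFDeriv ℂ j f 0 = 0

namespace VanishesToOrder

variable {f g : E → ℂ} {k l : ℕ}

theorem mono (hf : VanishesToOrder f k) (h : l ≤ k) : VanishesToOrder f l :=
  ⟨hf.1, fun j hj => hf.2 j (hj.trans_le h)⟩

theorem of_analyticAt (hf : AnalyticAt ℂ f 0) : VanishesToOrder f 0 :=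
  ⟨hf, fun _ hj => absurd hj (Nat.not_lt_zero _)⟩

theorem of_apply_zero (hf : AnalyticAt ℂ f 0) (h0 : f 0 = 0) : VanishesToOrder f 1 := by
  refine ⟨hf, fun j hj => ?_⟩
  obtain rfl : j = 0 := by omega
  ext v
  simp [h0]

theorem congr (hf : VanishesToOrder f k) (h : f =ᶠ[𝓝 0] g) : VanishesToOrder g k := by
  refine ⟨hf.1.congr h, fun j hj => ?_⟩
  rw [← (h.iteratedFDeriv ℂ j).eq_of_nhds]
  exact hf.2 j hj

theorem zero (k : ℕ) : VanishesToOrder (fun _ : E => (0 : ℂ)) k := by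
  refine ⟨analyticAt_const, fun j _ => ?_⟩
  rw [iteratedFDeriv_fun_zero]
  rfl

theorem add (hf : VanishesToOrder f k) (hg : VanishesToOrder g k) :
    VanishesToOrder (fun t => f t + g t) k := by
  refine ⟨hf.1.add hg.1, fun j hj => ?_⟩
  have := iteratedFDeriv_add_apply (𝕜 := ℂ) (x := (0 : E)) (i := j) (f := f) (g := g)
    hf.1.contDiffAt hg.1.contDiffAt
  rw [hf.2 j hj, hg.2 j hj, add_zero] at this
  exact this

theorem sum {α : Type*} (s : Finset α) {F : α → E → ℂ}
    (hF : ∀ a ∈ s, VanishesToOrder (F a) k) : VanishesToOrder (fun t => ∑ a ∈ s, F a t) k := by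
  classical
  induction s using Finset.induction_on with
  | empty => simpa using zero k
  | insert a s ha ih =>
    simp only [Finset.sum_insert ha]
    exact (hF a (Finset.mem_insert_self a s)).add
      (ih fun b hb => hF b (Finset.mem_insert_of_mem hb))

/-- By the Leibniz bound, the `j`-th derivative of the product is controlled by products of
derivatives of orders `i` and `j - i`; if `j < k + l`, then `i < k` or `j - i < l`. -/
theorem mul (hf : VanishesToOrder f k) (hg : VanishesToOrder g l) :
    VanishesToOrder (fun t => f t * g t) (k + l) := by
  refine ⟨hf.1.mul hg.1, fun j hj => ?_⟩
  obtain ⟨u, hu, hfu⟩ := hf.1.eventually_analyticAt.exists_mem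
  obtain ⟨v, hv, hgv⟩ := hg.1.eventually_analyticAt.exists_mem
  obtain ⟨s, hs, hso, hs0⟩ := mem_nhds_iff.1 (inter_mem hu hv)
  have hfs : ContDiffOn ℂ j f s := fun x hx => (hfu x (hs hx).1).contDiffAt.contDiffWithinAt
  have hgs : ContDiffOn ℂ j g s := fun x hx => (hgv x (hs hx).2).contDiffAt.contDiffWithinAt
  have key := norm_iteratedFDerivWithin_mul_le hfs hgs hso.uniqueDiffOn hs0 (n := j) le_rfl
  simp only [iteratedFDerivWithin_of_isOpen _ hso hs0] at key
  rw [Finset.sum_eq_zero] at key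
  · exact norm_le_zero_iff.1 key
  · intro i hi
    rcases lt_or_ge i k with h | h
    · simp [hf.2 i h]
    · rw [hg.2 (j - i) (by have := Finset.mem_range.1 hi; omega)]
      simp

theorem const_mul (hf : VanishesToOrder f k) (c : ℂ) : VanishesToOrder (fun t => c * f t) k := by
  simpa using (of_analyticAt (E := E) (f := fun _ => c) analyticAt_const).mul hf

theorem prod {α : Type*} (s : Finset α) {F : α → E → ℂ} {d : α → ℕ}
    (hF : ∀ a ∈ s, VanishesToOrder (F a) (d a)) :
    VanishesToOrder (fun t => ∏ a ∈ s, F a t) (∑ a ∈ s, d a) := by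
  classical
  induction s using Finset.induction_on with
  | empty => simpa using of_analyticAt (E := E) (f := fun _ => (1 : ℂ)) analyticAt_const
  | insert a s ha ih =>
    simp only [Finset.prod_insert ha, Finset.sum_insert ha]
    exact (hF a (Finset.mem_insert_self a s)).mul
      (ih fun b hb => hF b (Finset.mem_insert_of_mem hb))

/-- A determinant vanishes to order the number of its rows which vanish at the origin. -/
theorem det {α : Type*} [Fintype α] [DecidableEq α] {B : α → α → E → ℂ} (R : Finset α)
    (hB : ∀ i j, AnalyticAt ℂ (B i j) 0) (hR : ∀ i ∈ R, ∀ j, B i j 0 = 0) :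
    VanishesToOrder (fun t => Matrix.det (Matrix.of fun i j => B i j t)) R.card := by
  have h (t : E) : Matrix.det (Matrix.of fun i j => B i j t) =
      ∑ σ : Equiv.Perm α, ((Equiv.Perm.sign σ : ℤ) : ℂ) * ∏ i, B i (σ i) t := by
    rw [← Matrix.det_transpose, Matrix.det_apply']
    simp
  simp only [h]
  refine sum _ fun σ _ => const_mul ?_ _
  have := prod (E := E) Finset.univ (F := fun i t => B i (σ i) t)
    (d := fun i => if i ∈ R then 1 else 0) (fun i _ => ?_)
  · simpa using this
  · split_ifs with hi
    · exact of_apply_zero (hB _ _) (hR i hi _)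
    · exact of_analyticAt (hB _ _)

end VanishesToOrder

end Vanishing

/-! ### Osculating spaces and linear functionals -/

theorem rep_eq_smul {ι : Type} {p : ℙ ℂ (ι → ℂ)} {x : ι → ℂ} (h : x ≠ 0)
    (hp : Projectivization.mk ℂ x h = p) : ∃ c : ℂ, c ≠ 0 ∧ p.rep = c • x := by
  have h1 : Projectivization.mk ℂ p.rep p.rep_nonzero = Projectivization.mk ℂ x h := by
    rw [Projectivization.mk_rep, hp]
  obtain ⟨a, ha⟩ := (Projectivization.mk_eq_mk_iff ℂ _ _ _ _).1 h1
  exact ⟨a, a.ne_zero, ha.symm⟩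

theorem rep_mem_linearSpan {ι : Type} {X : Set (ℙ ℂ (ι → ℂ))} {p : ℙ ℂ (ι → ℂ)} (hp : p ∈ X) :
    p.rep ∈ linearSpan X :=
  Submodule.subset_span ⟨p.rep_nonzero, by rwa [p.mk_rep]⟩

section General

variable {ι : Type} [Fintype ι]

theorem apply_partialDeriv_eq_zero {m s k : ℕ} {φ : (Fin m → ℂ) → (ι → ℂ)}
    (hφ : AnalyticAt ℂ φ 0) (y : (ι → ℂ) →ₗ[ℂ] ℂ)
    (hy : VanishesToOrder (fun t => y (φ t)) (s + 1)) (hk : k ≤ s) (i : Fin k → Fin m) :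
    y (partialDeriv φ i) = 0 := by
  have h := (LinearMap.toContinuousLinearMap y).iteratedFDeriv_comp_left
    (x := 0) (f := φ) (n := k) hφ.contDiffAt (i := k) le_rfl
  have h2 := hy.2 k (by omega)
  have h3 : (LinearMap.toContinuousLinearMap y) ∘ φ = fun t => y (φ t) := rfl
  rw [h3, h2] at h
  have := congrArg (fun F => F (fun j => Pi.single (i j) 1)) h
  simpa [partialDeriv] using this.symm

/-- Testing on all analytic germs in the variety through `p` makes the bound independent of the
parametrization; neither the immersion property nor the affine chart plays a role. -/
theorem IsOsculatingSpace.le_ker {X : Set (ℙ ℂ (ι → ℂ))} {p : ℙ ℂ (ι → ℂ)} {s : ℕ}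
    {T : Submodule ℂ (ι → ℂ)} (hT : IsOsculatingSpace X p s T) (y : (ι → ℂ) →ₗ[ℂ] ℂ)
    (hy : ∀ (m : ℕ) (φ : (Fin m → ℂ) → (ι → ℂ)), AnalyticAt ℂ φ 0 →
      (∀ᶠ t in 𝓝 0, ∃ h : φ t ≠ 0, Projectivization.mk ℂ (φ t) h ∈ X) →
      (∃ h : φ 0 ≠ 0, Projectivization.mk ℂ (φ 0) h = p) →
      VanishesToOrder (fun t => y (φ t)) (s + 1)) : T ≤ LinearMap.ker y := by
  obtain ⟨m, ℓ, U, φ, hφ, rfl⟩ := hT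
  rw [Submodule.span_le]
  rintro x ⟨k, hk, i, rfl⟩
  have ha := hφ.holomorphic 0 hφ.zero_mem
  refine apply_partialDeriv_eq_zero ha y (hy m φ ha ?_ hφ.base) hk i
  filter_upwards [hφ.isOpen.mem_nhds hφ.zero_mem] with t ht using (hφ.mapsTo ht).2

/-- By duality: a linear form vanishing on the linear span is identically zero along the
parametrization, so it kills all the derivatives. -/
theorem IsOsculatingSpace.le_linearSpan {X : Set (ℙ ℂ (ι → ℂ))} {p : ℙ ℂ (ι → ℂ)} {s : ℕ}
    {T : Submodule ℂ (ι → ℂ)} (hT : IsOsculatingSpace X p s T) : T ≤ linearSpan X := by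
  intro x hx
  by_contra hxM
  obtain ⟨y, hyx, hyM⟩ := Submodule.exists_le_ker_of_notMem hxM
  refine hyx ?_
  refine hT.le_ker y (fun m φ _ hφ _ => ?_) hx
  refine (VanishesToOrder.zero (s + 1)).congr ?_
  filter_upwards [hφ] with t ht
  exact (hyM (Submodule.subset_span ht)).symm

/-- The linear form on `ℂ^κ` as a polynomial. -/
def linearPoly {κ : Type*} [Fintype κ] [DecidableEq κ] (y : (κ → ℂ) →ₗ[ℂ] ℂ) :
    MvPolynomial κ ℂ :=
  ∑ i, MvPolynomial.C (y (Pi.single i 1)) * MvPolynomial.X i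

theorem linearPoly_isHomogeneous {κ : Type*} [Fintype κ] [DecidableEq κ] (y : (κ → ℂ) →ₗ[ℂ] ℂ) :
    (linearPoly y).IsHomogeneous 1 :=
  MvPolynomial.IsHomogeneous.sum _ _ _ fun _ _ => MvPolynomial.isHomogeneous_C_mul_X _ _

theorem eval_linearPoly {κ : Type*} [Fintype κ] [DecidableEq κ] (y : (κ → ℂ) →ₗ[ℂ] ℂ)
    (x : κ → ℂ) : MvPolynomial.eval x (linearPoly y) = y x := by
  conv_rhs => rw [pi_eq_sum_univ' x]
  simp only [linearPoly, map_sum, map_mul, MvPolynomial.eval_C, MvPolynomial.eval_X, map_smul,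
    smul_eq_mul]
  refine Finset.sum_congr rfl fun i _ => ?_
  rw [mul_comm]

/-- If finitely many linear functionals vanish on the center of a projection, and if the points of
`X` at which one of them does not vanish are recovered from their values by homogeneous
polynomials, then the projection is birational. -/
theorem ProjectionIsBirational.of_recovery {M : Submodule ℂ (ι → ℂ)} {X : Set (ℙ ℂ (ι → ℂ))}
    {T : Submodule ℂ (ι → ℂ)} (hTM : T ≤ M) (hXM : ∀ p ∈ X, p.rep ∈ M)
    {κ : Type*} (y : κ → (ι → ℂ) →ₗ[ℂ] ℂ)
    (hy : ∀ j, T ≤ LinearMap.ker (y j)) (j₀ : κ) (hne : ∃ p ∈ X, y j₀ p.rep ≠ 0) (d : ℕ)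
    (G : ι → MvPolynomial κ ℂ) (hG : ∀ i, (G i).IsHomogeneous d)
    (hrec : ∀ p ∈ X, y j₀ p.rep ≠ 0 →
      ∃ c : ℂ, c ≠ 0 ∧ ∀ i, MvPolynomial.eval (fun j => y j p.rep) (G i) = c * p.rep i) :
    ProjectionIsBirational M X T := by
  classical
  refine ⟨hTM, fun k L hL hker => ?_⟩
  obtain ⟨σ, hσ⟩ := L.exists_rightInverse_of_surjective (LinearMap.range_eq_top.2 hL)
  have hσ' (z) : L (σ z) = z := LinearMap.congr_fun hσ z
  -- Since `y j` vanishes on `T`, it factors through `L`; composing with a linear section of `L`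
  -- gives the factor `A j`.
  let A : κ → (Fin k → ℂ) →ₗ[ℂ] ℂ := fun j => (y j).comp (M.subtype.comp σ)
  have hA (j : κ) (x : M) : A j (L x) = y j x := by
    have hmem : σ (L x) - x ∈ LinearMap.ker L := by
      rw [LinearMap.mem_ker, map_sub, hσ', sub_self]
    rw [hker] at hmem
    have h0 : y j ((σ (L x) - x : M) : ι → ℂ) = 0 := hy j hmem
    rw [Submodule.coe_sub, map_sub, sub_eq_zero] at h0
    exact h0
  refine ⟨{p | ∀ f ∈ ({linearPoly (y j₀)} : Set (MvPolynomial ι ℂ)),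
    MvPolynomial.eval p.rep f = 0}, ⟨_, ?_, rfl⟩, ?_, d,
    fun i => MvPolynomial.aeval (fun j => linearPoly (A j)) (G i), fun i => ?_, ?_⟩
  · rintro f rfl
    exact ⟨1, linearPoly_isHomogeneous _⟩
  · obtain ⟨p, hp, hp0⟩ := hne
    exact ⟨p, hp, by simpa [eval_linearPoly] using hp0⟩
  · simpa using (hG i).aeval (n := 1) (fun j => linearPoly (A j))
      (fun j => linearPoly_isHomogeneous _)
  · rintro p ⟨hp, hpZ⟩
    have hp0 : y j₀ p.rep ≠ 0 := by simpa [eval_linearPoly] using hpZ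
    obtain ⟨c, hc, hcG⟩ := hrec p hp hp0
    have hpM := hXM p hp
    have heval (i : ι) : MvPolynomial.eval (L ⟨p.rep, hpM⟩)
        (MvPolynomial.aeval (fun j => linearPoly (A j)) (G i)) = c * p.rep i := by
      rw [← hcG i, MvPolynomial.aeval_def, MvPolynomial.eval_eval₂]
      have h1 : (MvPolynomial.eval (L ⟨p.rep, hpM⟩)).comp
          (algebraMap ℂ (MvPolynomial (Fin k) ℂ)) = RingHom.id ℂ := by
        ext z
        simp [MvPolynomial.algebraMap_eq]
      simp only [h1, eval_linearPoly, hA]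
      rfl
    have hfun : (fun i => MvPolynomial.eval (L ⟨p.rep, hpM⟩)
        (MvPolynomial.aeval (fun j => linearPoly (A j)) (G i))) = c • p.rep := by
      ext i
      exact heval i
    refine ⟨hpM, fun h0 => hp0 ?_, ?_, ?_⟩
    · rw [← hA j₀ ⟨p.rep, hpM⟩, h0, map_zero]
    · rw [hfun]
      exact smul_ne_zero hc p.rep_nonzero
    · conv_rhs => rw [← p.mk_rep]
      rw [Projectivization.mk_eq_mk_iff]
      exact ⟨Units.mk0 c hc, hfun.symm⟩

end General

/-! ### Linear functionals on the Plücker space -/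

section Plucker

variable {n : ℕ}

/-- `w ↦ det (ℓ i (w j))` as an alternating map. -/
def detAlternating (ℓ : Fin n → (Fin (n + n) → ℂ) →ₗ[ℂ] ℂ) :
    (Fin (n + n) → ℂ) [⋀^Fin n]→ₗ[ℂ] ℂ :=
  (Matrix.detRowAlternating (R := ℂ) (n := Fin n)).compLinearMap (LinearMap.pi ℓ)

theorem detAlternating_apply (ℓ : Fin n → (Fin (n + n) → ℂ) →ₗ[ℂ] ℂ)
    (w : Fin n → (Fin (n + n) → ℂ)) :
    detAlternating ℓ w = Matrix.det (Matrix.of fun i j => ℓ i (w j)) := by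
  rw [← Matrix.det_transpose]
  rfl

theorem alternatingMap_sum_apply {α : Type*} (s : Finset α)
    (F : α → (Fin (n + n) → ℂ) [⋀^Fin n]→ₗ[ℂ] ℂ) (w : Fin n → (Fin (n + n) → ℂ)) :
    (∑ x ∈ s, F x) w = ∑ x ∈ s, F x w := by
  classical
  induction s using Finset.induction_on with
  | empty => simp
  | insert x s hx ih => rw [Finset.sum_insert hx, Finset.sum_insert hx, AlternatingMap.add_apply, ih]

/-- The linear functional on the Plücker space given on `w_1 ∧ ⋯ ∧ w_n` by `det (ℓ i (w j))`. -/
def pluckerFunctional (ℓ : Fin n → (Fin (n + n) → ℂ) →ₗ[ℂ] ℂ) :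
    (PluckerIndex n → ℂ) →ₗ[ℂ] ℂ :=
  ∑ J : PluckerIndex n, detAlternating ℓ (fun j => Pi.single (J j) 1) • LinearMap.proj J

theorem pluckerVector_single (J J' : PluckerIndex n) :
    pluckerVector (fun j => Pi.single (J j) (1 : ℂ)) J' = if J' = J then 1 else 0 := by
  unfold pluckerVector
  split_ifs with h
  · subst h
    have h1 : (Matrix.of fun i j => (Pi.single (J' j) (1 : ℂ) : Fin (n + n) → ℂ) (J' i)) = 1 := by
      ext i j
      simp [Matrix.one_apply, Pi.single_apply]
    rw [h1, Matrix.det_one]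
  · have hr : ¬ Set.range J' ⊆ Set.range J := by
      intro hsub
      apply h
      have hfin : Set.range J' = Set.range J := by
        refine Set.eq_of_subset_of_ncard_le hsub ?_
        rw [Set.ncard_eq_toFinset_card', Set.ncard_eq_toFinset_card', Set.toFinset_range,
          Set.toFinset_range, Finset.card_image_of_injective _ J.injective,
          Finset.card_image_of_injective _ J'.injective]
      exact OrderEmbedding.range_inj.1 hfin
    obtain ⟨_, ⟨i, rfl⟩, hi⟩ := Set.not_subset.1 hr
    refine Matrix.det_eq_zero_of_row_eq_zero i fun j => ?_
    have : J' i ≠ J j := fun h => hi ⟨j, h.symm⟩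
    simp [this]

/-- A form of Cauchy–Binet. Both sides are alternating in `w`, so it suffices to take distinct basis
vectors, which a permutation puts in increasing order. -/
theorem pluckerFunctional_pluckerVector (ℓ : Fin n → (Fin (n + n) → ℂ) →ₗ[ℂ] ℂ)
    (w : Fin n → (Fin (n + n) → ℂ)) :
    pluckerFunctional ℓ (pluckerVector w) = Matrix.det (Matrix.of fun i j => ℓ i (w j)) := by
  have h : (∑ J : PluckerIndex n, detAlternating ℓ (fun j => Pi.single (J j) 1) •
      detAlternating (fun i => LinearMap.proj (J i))) = detAlternating ℓ := by
    refine (Pi.basisFun ℂ (Fin (n + n))).ext_alternating fun v hv => ?_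
    have hmono : StrictMono (v ∘ Tuple.sort v) :=
      (Tuple.monotone_sort v).strictMono_of_injective (hv.comp (Tuple.sort v).injective)
    let J₀ : PluckerIndex n := OrderEmbedding.ofStrictMono _ hmono
    have hv' : (fun i => Pi.basisFun ℂ (Fin (n + n)) (v i)) =
        (fun j => Pi.single (J₀ j) (1 : ℂ)) ∘ (Tuple.sort v).symm := by
      ext i
      simp [J₀]
    rw [hv', AlternatingMap.map_perm, AlternatingMap.map_perm]
    congr 1
    have hJ (J : PluckerIndex n) : detAlternating (fun i => LinearMap.proj (J i))
        (fun j => Pi.single (J₀ j) (1 : ℂ)) = if J = J₀ then 1 else 0 := by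
      rw [← pluckerVector_single, detAlternating_apply]
      rfl
    simp [alternatingMap_sum_apply, hJ]
  rw [← detAlternating_apply, ← h]
  simp only [pluckerFunctional, LinearMap.sum_apply, alternatingMap_sum_apply, LinearMap.smul_apply,
    AlternatingMap.smul_apply, detAlternating_apply]
  rfl

/-- Cramer's rule. -/
theorem pluckerFunctional_mul_apply (r : Fin n → (Fin (n + n) → ℂ) →ₗ[ℂ] ℂ)
    (f : (Fin (n + n) → ℂ) →ₗ[ℂ] ℂ) (c : ℂ) (w : Fin n → (Fin (n + n) → ℂ)) (j : Fin n) :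
    pluckerFunctional r (c • pluckerVector w) * f (w j) =
      ∑ i, pluckerFunctional (Function.update r i f) (c • pluckerVector w) * r i (w j) := by
  have h := congrFun (Matrix.mulVec_cramer (Matrix.of fun i j => r i (w j)).transpose (fun j => f (w j))) j
  simp only [Matrix.mulVec, dotProduct, Matrix.cramer_transpose_apply, Matrix.transpose_apply,
    Matrix.of_apply, Matrix.det_transpose, Pi.smul_apply, smul_eq_mul] at h
  simp only [map_smul, smul_eq_mul, pluckerFunctional_pluckerVector, mul_assoc, ← h,
    Finset.mul_sum]
  refine Finset.sum_congr rfl fun i _ => ?_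
  rw [mul_comm (r i (w j))]
  congr 3
  ext k l
  by_cases hk : k = i
  · subst hk
    simp
  · simp [hk]

/-- On an analytic family of subspaces whose member at the origin is killed by the functionals
`ℓ i`, `i ∈ R`, the function `det (ℓ i (w j))` vanishes to order `#R`. -/
theorem vanishesToOrder_pluckerFunctional {m : ℕ} {φ : (Fin m → ℂ) → (PluckerIndex n → ℂ)}
    (hφ : AnalyticAt ℂ φ 0)
    (hpl : ∀ᶠ t in 𝓝 0, ∃ (c : ℂ) (w : Fin n → (Fin (n + n) → ℂ)), φ t = c • pluckerVector w)
    {c₀ : ℂ} {w₀ : Fin n → (Fin (n + n) → ℂ)} (h₀ : φ 0 = c₀ • pluckerVector w₀)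
    (r ℓ : Fin n → (Fin (n + n) → ℂ) →ₗ[ℂ] ℂ) (hr : pluckerFunctional r (φ 0) ≠ 0)
    (R : Finset (Fin n)) (hR : ∀ i ∈ R, ∀ j, ℓ i (w₀ j) = 0) :
    VanishesToOrder (fun t => pluckerFunctional ℓ (φ t)) R.card := by
  have han (f : (PluckerIndex n → ℂ) →ₗ[ℂ] ℂ) : AnalyticAt ℂ (fun t => f (φ t)) 0 :=
    ((LinearMap.toContinuousLinearMap f).analyticAt _).comp hφ
  -- By Cramer's rule these ratios are the coefficients of `ℓ k` in terms of the `r i` on the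
  -- subspace at `t`. They depend analytically on `φ t`, so no analytic choice of the spanning
  -- vectors is needed. Their determinant is `det ℓ / det r`, and its rows in `R` vanish at the
  -- origin.
  have hBan (k i : Fin n) : AnalyticAt ℂ (fun t =>
      pluckerFunctional (Function.update r i (ℓ k)) (φ t) / pluckerFunctional r (φ t)) 0 :=
    (han _).div (han _) hr
  have hdet := VanishesToOrder.det R hBan (fun k hk i => by
    rw [h₀, map_smul, pluckerFunctional_pluckerVector, Matrix.det_eq_zero_of_row_eq_zero i]
    · simp
    · intro j
      simp [hR k hk j])
  have hmul := (VanishesToOrder.of_analyticAt (han (pluckerFunctional r))).mul hdet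
  rw [zero_add] at hmul
  refine hmul.congr ?_
  filter_upwards [hpl, (han (pluckerFunctional r)).continuousAt.eventually_ne hr] with t ht hrt
  obtain ⟨c, w, hw⟩ := ht
  have hc := pluckerFunctional_mul_apply r (w := w) (c := c)
  rw [hw] at hrt ⊢
  have hprod : (Matrix.of fun k i => pluckerFunctional (Function.update r i (ℓ k))
      (c • pluckerVector w) / pluckerFunctional r (c • pluckerVector w)) *
      (Matrix.of fun i j => r i (w j)) = Matrix.of fun k j => ℓ k (w j) := by
    ext k j
    simp only [Matrix.mul_apply, Matrix.of_apply]
    rw [eq_comm, ← mul_right_inj' hrt, hc (ℓ k) j, Finset.mul_sum]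
    refine Finset.sum_congr rfl fun i _ => ?_
    field_simp
  simp only [map_smul, smul_eq_mul, pluckerFunctional_pluckerVector ℓ,
    pluckerFunctional_pluckerVector r, ← hprod, Matrix.det_mul] at hrt ⊢
  ring

theorem pluckerVector_sum_smul (v : Fin n → (Fin (n + n) → ℂ)) (N : Matrix (Fin n) (Fin n) ℂ) :
    pluckerVector (fun j => ∑ i, N i j • v i) = N.det • pluckerVector v := by
  ext J
  simp only [pluckerVector, Pi.smul_apply, smul_eq_mul]
  rw [mul_comm, ← Matrix.det_mul]
  congr 1
  ext i j
  simp [Matrix.mul_apply, mul_comm]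

theorem pluckerVector_smul (v : Fin n → (Fin (n + n) → ℂ)) (c : ℂ) :
    pluckerVector (fun j => c • v j) = c ^ n • pluckerVector v := by
  ext J
  simp only [pluckerVector, Pi.smul_apply, smul_eq_mul]
  have h := Matrix.det_smul (Matrix.of fun i j => v j (J i)) c
  rw [Fintype.card_fin] at h
  rw [← h]
  rfl

/-- A subspace in a standard chart is recovered from its linear coordinates in the chart. -/
theorem pluckerVector_recovery {a c : Fin n → (Fin (n + n) → ℂ) →ₗ[ℂ] ℂ}
    {b d : Fin n → (Fin (n + n) → ℂ)} (hdual : ∀ v, v = ∑ i, (a i v • b i + c i v • d i))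
    {x : PluckerIndex n → ℂ} {μ : ℂ} {w : Fin n → (Fin (n + n) → ℂ)} (hx : x = μ • pluckerVector w)
    (h0 : pluckerFunctional a x ≠ 0) :
    pluckerVector (fun i => pluckerFunctional a x • b i +
      ∑ k, pluckerFunctional (Function.update a i (c k)) x • d k) =
      (pluckerFunctional a x ^ n / pluckerFunctional a x) • x := by
  set y := pluckerFunctional a x with hy
  set v := fun i => y • b i + ∑ k, pluckerFunctional (Function.update a i (c k)) x • d k with hv
  -- The `v i` span the same subspace as the `w j`, the change of basis being `a i (w j)` up to the
  -- scalar `y`.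
  have hw (j : Fin n) : ∑ i, a i (w j) • v i = y • w j := by
    have hc (k : Fin n) := pluckerFunctional_mul_apply a (c k) μ w j
    simp only [← hx, ← hy] at hc
    conv_rhs => rw [hdual (w j)]
    simp only [hv, smul_add, Finset.smul_sum, Finset.sum_add_distrib, smul_smul]
    congr 1
    · exact Finset.sum_congr rfl fun i _ => by rw [mul_comm]
    · rw [Finset.sum_comm]
      refine Finset.sum_congr rfl fun k _ => ?_
      rw [hc k, Finset.sum_smul]
      exact Finset.sum_congr rfl fun i _ => by rw [mul_comm]
  have h1 := pluckerVector_sum_smul v (Matrix.of fun i j => a i (w j))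
  simp only [Matrix.of_apply, hw, pluckerVector_smul] at h1
  rw [← pluckerFunctional_pluckerVector] at h1
  have h2 : y = μ * pluckerFunctional a (pluckerVector w) := by
    rw [hy, hx, map_smul, smul_eq_mul]
  have h3 : y • pluckerVector v = y ^ n • x := by
    rw [hx, smul_comm, h1, smul_smul, ← h2]
  -- The factor is kept as `y ^ n / y`, since truncated subtraction would make `y ^ (n - 1)` wrong
  -- for `n = 0`.
  rw [div_eq_inv_mul, mul_smul, ← h3, smul_smul, inv_mul_cancel₀ h0, one_smul]

theorem exists_smul_pluckerVector {S : Set (Submodule ℂ (Fin (n + n) → ℂ))}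
    {x : PluckerIndex n → ℂ} (h : x ≠ 0) (hx : Projectivization.mk ℂ x h ∈ pluckerImage S) :
    ∃ (c : ℂ) (w : Fin n → (Fin (n + n) → ℂ)), x = c • pluckerVector w := by
  obtain ⟨W, -, b, hb, hmk⟩ := hx
  obtain ⟨a, ha⟩ := (Projectivization.mk_eq_mk_iff ℂ _ _ _ _).1 hmk.symm
  exact ⟨a, _, ha.symm⟩

/-- The criterion for birationality of osculating projections in a Plücker embedding: `a` and `c`
are dual to a basis of `ℂ^{2n}`, and both `a` and the families obtained from it by substituting
some `c k` for some `a i` contain more than `s` functionals killing the center. -/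
theorem projectionIsBirational_pluckerImage {S : Set (Submodule ℂ (Fin (n + n) → ℂ))} {s : ℕ}
    {w₀ : Fin n → (Fin (n + n) → ℂ)} (hw₀ : pluckerVector w₀ ≠ 0)
    {T : Submodule ℂ (PluckerIndex n → ℂ)}
    (hT : IsOsculatingSpace (pluckerImage S) (Projectivization.mk ℂ _ hw₀) s T)
    {r a c : Fin n → (Fin (n + n) → ℂ) →ₗ[ℂ] ℂ}
    {b d : Fin n → (Fin (n + n) → ℂ)} (hdual : ∀ v, v = ∑ i, (a i v • b i + c i v • d i))
    (hr : Matrix.det (Matrix.of fun i j => r i (w₀ j)) ≠ 0)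
    (ha : ∃ R : Finset (Fin n), s + 1 ≤ R.card ∧ ∀ i ∈ R, ∀ j, a i (w₀ j) = 0)
    (hac : ∀ l k, ∃ R : Finset (Fin n), s + 1 ≤ R.card ∧
      ∀ i ∈ R, ∀ j, Function.update a l (c k) i (w₀ j) = 0)
    {W : Submodule ℂ (Fin (n + n) → ℂ)} (hW : W ∈ S) (w : Module.Basis (Fin n) ℂ W)
    (hwa : Matrix.det (Matrix.of fun i j => a i (w j)) ≠ 0) :
    ProjectionIsBirational (linearSpan (pluckerImage S)) (pluckerImage S) T := by
  have hvan (ℓ : Fin n → (Fin (n + n) → ℂ) →ₗ[ℂ] ℂ)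
      (hℓ : ∃ R : Finset (Fin n), s + 1 ≤ R.card ∧ ∀ i ∈ R, ∀ j, ℓ i (w₀ j) = 0) :
      T ≤ LinearMap.ker (pluckerFunctional ℓ) := by
    obtain ⟨R, hRs, hR⟩ := hℓ
    refine hT.le_ker _ fun m φ hφ hφX hφ0 => ?_
    obtain ⟨h0, hφ0⟩ := hφ0
    obtain ⟨u, hu⟩ := (Projectivization.mk_eq_mk_iff ℂ _ _ _ _).1 hφ0
    have hu' : φ 0 = (u : ℂ) • pluckerVector w₀ := hu.symm
    refine (vanishesToOrder_pluckerFunctional hφ ?_ hu' r ℓ ?_ R hR).mono hRs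
    · filter_upwards [hφX] with t ht
      obtain ⟨h, ht⟩ := ht
      exact exists_smul_pluckerVector h ht
    · rw [hu', map_smul, pluckerFunctional_pluckerVector]
      exact mul_ne_zero u.ne_zero hr
  -- The index `none` carries the common denominator of the chart coordinates, the index `some (i,
  -- k)` the numerator of the entry `(i, k)`.
  let y : Option (Fin n × Fin n) → (PluckerIndex n → ℂ) →ₗ[ℂ] ℂ := fun o =>
    o.elim (pluckerFunctional a) fun q => pluckerFunctional (Function.update a q.1 (c q.2))
  let v (i : Fin n) (k : Fin (n + n)) : MvPolynomial (Option (Fin n × Fin n)) ℂ :=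
    MvPolynomial.C (b i k) * MvPolynomial.X none +
      ∑ l, MvPolynomial.C (d l k) * MvPolynomial.X (some (i, l))
  have hv (i k) : (v i k).IsHomogeneous 1 :=
    (MvPolynomial.isHomogeneous_C_mul_X _ _).add
      (MvPolynomial.IsHomogeneous.sum _ _ _ fun _ _ => MvPolynomial.isHomogeneous_C_mul_X _ _)
  refine ProjectionIsBirational.of_recovery hT.le_linearSpan (fun p hp => rep_mem_linearSpan hp)
    y ?_ none ?_ n (fun J => Matrix.det (Matrix.of fun i j => v j (J i))) ?_ ?_
  · rintro (_ | ⟨i, k⟩)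
    · exact hvan _ ha
    · exact hvan _ (hac i k)
  · have hne : pluckerVector (fun j => (w j : Fin (n + n) → ℂ)) ≠ 0 := by
      intro h
      apply hwa
      rw [← pluckerFunctional_pluckerVector, h, map_zero]
    refine ⟨Projectivization.mk ℂ _ hne, ⟨W, hW, w, hne, rfl⟩, ?_⟩
    obtain ⟨u, hu, hrep⟩ := rep_eq_smul hne rfl
    rw [hrep, map_smul]
    refine smul_ne_zero hu ?_
    change pluckerFunctional a _ ≠ 0
    rwa [pluckerFunctional_pluckerVector]
  · intro J
    rw [Matrix.det_apply]
    refine MvPolynomial.IsHomogeneous.sum _ _ _ fun σ _ => ?_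
    have := MvPolynomial.IsHomogeneous.prod Finset.univ
      (fun i => (Matrix.of fun i j => v j (J i)) (σ i) i) (fun _ => 1) fun i _ => hv _ _
    simp only [Finset.sum_const, Finset.card_univ, Fintype.card_fin, smul_eq_mul, mul_one] at this
    rcases Int.units_eq_one_or (Equiv.Perm.sign σ) with h | h
    · rw [h, one_smul]
      exact this
    · rw [h, Units.neg_smul, one_smul]
      exact this.neg
  · intro p hp hp0
    obtain ⟨μ, w', hw'⟩ := exists_smul_pluckerVector p.rep_nonzero (by rwa [p.mk_rep])
    have hrec := pluckerVector_recovery hdual hw' hp0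
    refine ⟨_, div_ne_zero (pow_ne_zero n hp0) hp0, fun J => ?_⟩
    have hJ := congrFun hrec J
    rw [Pi.smul_apply, smul_eq_mul] at hJ
    refine Eq.trans ?_ hJ
    simp only [pluckerVector]
    rw [RingHom.map_det]
    congr 1
    ext i j
    simp [v, y, mul_comm]

end Plucker

/-! ### Coordinate maximal isotropic subspaces -/

section Coordinate

variable {n : ℕ}

theorem mem_symmDiff_singleton_of_ne {I : Finset (Fin n)} {i k : Fin n} (h : k ≠ i) :
    k ∈ I ∆ {i} ↔ k ∈ I := by
  simp [Finset.mem_symmDiff, h]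

theorem mem_symmDiff_singleton_self {I : Finset (Fin n)} {i : Fin n} : i ∈ I ∆ {i} ↔ i ∉ I := by
  simp [Finset.mem_symmDiff]

theorem symmDiff_singleton_of_mem {I : Finset (Fin n)} {i : Fin n} (h : i ∈ I) :
    I ∆ {i} = I.erase i := by
  ext k
  by_cases hk : k = i
  · subst hk
    simp [h, Finset.mem_symmDiff]
  · simp [hk, Finset.mem_symmDiff]

theorem symmDiff_singleton_of_notMem {I : Finset (Fin n)} {i : Fin n} (h : i ∉ I) :
    I ∆ {i} = insert i I := by
  ext k
  by_cases hk : k = i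
  · subst hk
    simp [h, Finset.mem_symmDiff]
  · simp [hk, Finset.mem_symmDiff]

theorem card_symmDiff_singleton (I : Finset (Fin n)) (i : Fin n) :
    (I ∆ {i}).card + 1 = I.card ∨ (I ∆ {i}).card = I.card + 1 := by
  by_cases h : i ∈ I
  · left
    rw [symmDiff_singleton_of_mem h, Finset.card_erase_add_one h]
  · right
    rw [symmDiff_singleton_of_notMem h, Finset.card_insert_of_notMem h]

/-- The index of `e_i` if `i ∈ I`, and of `f_i` if `i ∉ I`. -/
def coordIdx (I : Finset (Fin n)) (i : Fin n) : Fin (n + n) :=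
  if i ∈ I then Fin.castAdd n i else Fin.natAdd n i

theorem coordIdx_congr {I J : Finset (Fin n)} {i : Fin n} (h : i ∈ I ↔ i ∈ J) :
    coordIdx I i = coordIdx J i := by
  simp [coordIdx, h]

theorem coordIdx_eq_iff {I J : Finset (Fin n)} {i j : Fin n} :
    coordIdx I i = coordIdx J j ↔ i = j ∧ (i ∈ I ↔ i ∈ J) := by
  unfold coordIdx
  constructor
  · intro h
    have hi := i.isLt
    have hj := j.isLt
    split_ifs at h <;> simp only [Fin.ext_iff, Fin.val_castAdd, Fin.val_natAdd] at h
    · obtain rfl : i = j := Fin.ext h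
      simp [*]
    · omega
    · omega
    · obtain rfl : i = j := Fin.ext (by omega)
      simp [*]
  · rintro ⟨rfl, h⟩
    simp [h]

theorem coordIdx_injective (I : Finset (Fin n)) : Function.Injective (coordIdx I) :=
  fun _ _ h => (coordIdx_eq_iff.1 h).1

theorem coordIdx_compl_ne (I : Finset (Fin n)) (i j : Fin n) : coordIdx Iᶜ i ≠ coordIdx I j := by
  intro h
  have := (coordIdx_eq_iff.1 h).2
  simp at this

theorem coordIdx_cases (I : Finset (Fin n)) (k : Fin (n + n)) :
    (∃ i, k = coordIdx I i) ∨ ∃ i, k = coordIdx Iᶜ i := by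
  refine Fin.addCases (fun i => ?_) (fun i => ?_) k <;> by_cases h : i ∈ I
  · exact Or.inl ⟨i, by rw [coordIdx, if_pos h]⟩
  · exact Or.inr ⟨i, by rw [coordIdx, if_pos (by simpa using h)]⟩
  · exact Or.inr ⟨i, by rw [coordIdx, if_neg (by simpa using h)]⟩
  · exact Or.inl ⟨i, by rw [coordIdx, if_neg h]⟩

/-- The subspace spanned by the `e_i`, `i ∈ I`, and the `f_i`, `i ∉ I`. -/
def coordSubspace (I : Finset (Fin n)) : Submodule ℂ (Fin (n + n) → ℂ) where
  carrier := {v | ∀ i, v (coordIdx Iᶜ i) = 0}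
  add_mem' := fun hv hw i => by simp [hv i, hw i]
  zero_mem' := fun _ => rfl
  smul_mem' := fun c v hv i => by simp [hv i]

theorem mem_coordSubspace {I : Finset (Fin n)} {v : Fin (n + n) → ℂ} :
    v ∈ coordSubspace I ↔ ∀ i, v (coordIdx Iᶜ i) = 0 := Iff.rfl

theorem sum_coordIdx (I : Finset (Fin n)) (v : Fin (n + n) → ℂ) :
    v = ∑ i, (v (coordIdx I i) • Pi.single (coordIdx I i) (1 : ℂ) +
      v (coordIdx Iᶜ i) • Pi.single (coordIdx Iᶜ i) (1 : ℂ)) := by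
  ext k
  rw [Finset.sum_apply]
  rcases coordIdx_cases I k with ⟨i, rfl⟩ | ⟨i, rfl⟩
  · simp [Pi.single_apply, (coordIdx_injective I).eq_iff, (coordIdx_compl_ne I _ _).symm]
  · simp [Pi.single_apply, (coordIdx_injective Iᶜ).eq_iff, coordIdx_compl_ne I]

theorem finrank_of_forall_notMem {A : Finset (Fin (n + n))} {N : Submodule ℂ (Fin (n + n) → ℂ)}
    (hN : ∀ v, v ∈ N ↔ ∀ k ∉ A, v k = 0) : Module.finrank ℂ N = A.card := by
  have hN' : N = ⨅ k ∈ ((A : Set (Fin (n + n)))ᶜ),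
      LinearMap.ker (LinearMap.proj (R := ℂ) (φ := fun _ : Fin (n + n) => ℂ) k) := by
    ext v
    simp [hN, Submodule.mem_iInf]
  rw [hN', (LinearMap.iInfKerProjEquiv ℂ (fun _ : Fin (n + n) => ℂ)
    (I := (A : Set (Fin (n + n)))) (J := (A : Set (Fin (n + n)))ᶜ)
    disjoint_compl_right (by simp)).finrank_eq]
  simp

theorem finrank_coordSubspace (I : Finset (Fin n)) : Module.finrank ℂ (coordSubspace I) = n := by
  rw [finrank_of_forall_notMem (A := Finset.univ.image (coordIdx I)),
    Finset.card_image_of_injective _ (coordIdx_injective I), Finset.card_univ, Fintype.card_fin]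
  intro v
  rw [mem_coordSubspace]
  constructor
  · intro h k hk
    rcases coordIdx_cases I k with ⟨i, rfl⟩ | ⟨i, rfl⟩
    · simp at hk
    · exact h i
  · intro h i
    refine h _ ?_
    simp [(coordIdx_compl_ne I _ _).symm]

theorem baseSubspace_eq : baseSubspace n = coordSubspace Finset.univ := by
  apply le_antisymm
  · refine Submodule.span_le.2 ?_
    rintro _ ⟨i, rfl⟩ j
    have h : coordIdx Finset.univ i = Fin.castAdd n i := by simp [coordIdx]
    change (Pi.single (Fin.castAdd n i) (1 : ℂ) : Fin (n + n) → ℂ) (coordIdx Finset.univᶜ j) = 0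
    rw [← h]
    exact Pi.single_eq_of_ne (coordIdx_compl_ne _ _ _) _
  · intro v hv
    rw [sum_coordIdx Finset.univ v]
    refine Submodule.sum_mem _ fun i _ => ?_
    rw [hv i, zero_smul, add_zero]
    exact Submodule.smul_mem _ _ (Submodule.subset_span ⟨i, by simp [coordIdx]⟩)

/-- Consequently the parity of `I.card` decides in which of the two spinor families `coordSubspace
I` lies. -/
theorem finrank_coordSubspace_inf_base (I : Finset (Fin n)) :
    Module.finrank ℂ (coordSubspace I ⊓ baseSubspace n : Submodule ℂ (Fin (n + n) → ℂ)) =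
      I.card := by
  rw [baseSubspace_eq, finrank_of_forall_notMem (A := I.image (Fin.castAdd n)),
    Finset.card_image_of_injective _ (Fin.castAdd_injective n n)]
  intro v
  simp only [Submodule.mem_inf, mem_coordSubspace]
  constructor
  · rintro ⟨h1, h2⟩ k hk
    rcases coordIdx_cases Finset.univ k with ⟨i, rfl⟩ | ⟨i, rfl⟩
    · have hi : i ∉ I := by
        intro hi
        apply hk
        simp [coordIdx, hi]
      rw [← h1 i]
      exact congrArg v (coordIdx_congr (by simp [hi]))
    · exact h2 i
  · intro h
    refine ⟨fun i => h _ fun hk => ?_, fun i => h _ fun hk => ?_⟩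
    · obtain ⟨j, hj, hji⟩ := Finset.mem_image.1 hk
      have h3 : coordIdx I j = coordIdx Iᶜ i := by rw [← hji]; simp [coordIdx, hj]
      exact coordIdx_compl_ne _ _ _ h3.symm
    · obtain ⟨j, hj, hji⟩ := Finset.mem_image.1 hk
      have h3 : coordIdx Finset.univ j = coordIdx Finset.univᶜ i := by rw [← hji]; simp [coordIdx]
      exact coordIdx_compl_ne _ _ _ h3.symm

theorem single_mem_coordSubspace (I : Finset (Fin n)) (i : Fin n) :
    Pi.single (coordIdx I i) (1 : ℂ) ∈ coordSubspace I :=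
  fun _ => Pi.single_eq_of_ne (coordIdx_compl_ne I _ _) _

/-- The basis vectors spanning `coordSubspace I`. -/
def coordBasis (I : Finset (Fin n)) : Module.Basis (Fin n) ℂ (coordSubspace I) :=
  Module.Basis.mk
    (v := fun i => (⟨_, single_mem_coordSubspace I i⟩ : coordSubspace I))
    (by
      apply LinearIndependent.of_comp (coordSubspace I).subtype
      exact (Pi.linearIndependent_single_one (Fin (n + n)) ℂ).comp _ (coordIdx_injective I))
    (by
      rintro ⟨v, hv⟩ -
      have h : (⟨v, hv⟩ : coordSubspace I) = ∑ i, v (coordIdx I i) •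
          (⟨_, single_mem_coordSubspace I i⟩ : coordSubspace I) := by
        apply Subtype.ext
        rw [AddSubmonoidClass.coe_finsetSum]
        refine (sum_coordIdx I v).trans ?_
        exact Finset.sum_congr rfl fun i _ => by rw [hv i, zero_smul, add_zero]; rfl
      rw [h]
      exact Submodule.sum_mem _ fun i _ => Submodule.smul_mem _ _ (Submodule.subset_span ⟨i, rfl⟩))

theorem coe_coordBasis (I : Finset (Fin n)) (i : Fin n) :
    (coordBasis I i : Fin (n + n) → ℂ) = Pi.single (coordIdx I i) 1 := by
  simp [coordBasis]

/-- For `k ≠ i` the components of `v` and `w` in the plane of `e_k` and `f_k` lie on the same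
coordinate line, so only the `i`-th summand survives. The unspecified scalar `ε` lets the symplectic
and the quadratic forms share one transversality argument. -/
theorem sympForm_of_mem_coordSubspace {I : Finset (Fin n)} {i : Fin n} {v w : Fin (n + n) → ℂ}
    (hw : w ∈ coordSubspace I) (hv : v ∈ coordSubspace (I ∆ {i})) :
    ∃ ε : ℂ, ε ≠ 0 ∧ sympForm v w = ε * (v (coordIdx Iᶜ i) * w (coordIdx I i)) := by
  refine ⟨if i ∈ I then -1 else 1, by split_ifs <;> simp, ?_⟩
  unfold sympForm
  rw [Finset.sum_eq_single i]
  · have h1 := hw i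
    have h2 := hv i
    by_cases hi : i ∈ I <;>
      simp_all [coordIdx]
  · intro k _ hk
    have h1 := hw k
    have h2 := hv k
    by_cases hi : k ∈ I <;>
      simp_all [coordIdx]
  · simp

theorem quadForm_of_mem_coordSubspace {I : Finset (Fin n)} {i : Fin n} {v w : Fin (n + n) → ℂ}
    (hw : w ∈ coordSubspace I) (hv : v ∈ coordSubspace (I ∆ {i})) :
    ∃ ε : ℂ, ε ≠ 0 ∧ quadForm v w = ε * (v (coordIdx Iᶜ i) * w (coordIdx I i)) := by
  refine ⟨1, one_ne_zero, ?_⟩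
  unfold quadForm
  rw [Finset.sum_eq_single i]
  · have h1 := hw i
    have h2 := hv i
    by_cases hi : i ∈ I <;>
      simp_all [coordIdx]
  · intro k _ hk
    have h1 := hw k
    have h2 := hv k
    by_cases hi : k ∈ I <;>
      simp_all [coordIdx]
  · simp

theorem coordSubspace_mem_lagrangianSubspaces (I : Finset (Fin n)) :
    coordSubspace I ∈ lagrangianSubspaces n := by
  refine ⟨finrank_coordSubspace I, fun v hv w hw => Finset.sum_eq_zero fun k _ => ?_⟩
  have h1 := hw k
  have h2 := hv k
  by_cases hi : k ∈ I <;> simp_all [coordIdx]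

theorem quadForm_eq_zero_of_mem_coordSubspace {I : Finset (Fin n)} {v w : Fin (n + n) → ℂ}
    (hv : v ∈ coordSubspace I) (hw : w ∈ coordSubspace I) : quadForm v w = 0 := by
  refine Finset.sum_eq_zero fun k _ => ?_
  have h1 := hw k
  have h2 := hv k
  by_cases hi : k ∈ I <;> simp_all [coordIdx]

theorem coordSubspace_mem_spinorSubspaces {I : Finset (Fin n)} (hI : I.card ≡ n [MOD 2]) :
    coordSubspace I ∈ spinorSubspaces n := by
  refine ⟨finrank_coordSubspace I,
    fun v hv w hw => quadForm_eq_zero_of_mem_coordSubspace hv hw, ?_⟩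
  rwa [finrank_coordSubspace_inf_base]

theorem finrank_inf_ker_add_one {N : Submodule ℂ (Fin (n + n) → ℂ)}
    (f : (Fin (n + n) → ℂ) →ₗ[ℂ] ℂ) {w : Fin (n + n) → ℂ} (hw : w ∈ N) (hf : f w ≠ 0) :
    Module.finrank ℂ (N ⊓ LinearMap.ker f : Submodule ℂ (Fin (n + n) → ℂ)) + 1 =
      Module.finrank ℂ N := by
  have hg : f.comp N.subtype ≠ 0 := fun h => hf (LinearMap.congr_fun h ⟨w, hw⟩)
  rw [← Module.Dual.finrank_ker_add_one_of_ne_zero (f := f.comp N.subtype) hg,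
    ← Submodule.map_comap_subtype, Submodule.finrank_map_subtype_eq, LinearMap.ker_comp]

/-- An isotropic subspace which meets a coordinate isotropic subspace `E` nontrivially meets some
neighbour of `E` in a hyperplane of the intersection; iterating, it is transverse to some
coordinate isotropic subspace. -/
theorem exists_coordSubspace_inf_eq_bot {B : (Fin (n + n) → ℂ) → (Fin (n + n) → ℂ) → ℂ}
    (hB : ∀ {I : Finset (Fin n)} {i : Fin n} {v w : Fin (n + n) → ℂ},
      w ∈ coordSubspace I → v ∈ coordSubspace (I ∆ {i}) →
      ∃ ε : ℂ, ε ≠ 0 ∧ B v w = ε * (v (coordIdx Iᶜ i) * w (coordIdx I i)))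
    {W : Submodule ℂ (Fin (n + n) → ℂ)} (hW : ∀ v ∈ W, ∀ w ∈ W, B v w = 0) (d : ℕ) :
    ∀ I : Finset (Fin n),
      Module.finrank ℂ (W ⊓ coordSubspace I : Submodule ℂ (Fin (n + n) → ℂ)) = d →
      ∃ I' : Finset (Fin n), W ⊓ coordSubspace I' = ⊥ ∧ I'.card ≡ I.card + d [MOD 2] := by
  induction d with
  | zero => exact fun I hI => ⟨I, Submodule.finrank_eq_zero.1 hI, rfl⟩
  | succ d ih =>
    intro I hI
    have hne : W ⊓ coordSubspace I ≠ ⊥ := by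
      intro h
      rw [h, finrank_bot] at hI
      omega
    obtain ⟨w, ⟨hwW, hwI⟩, hw0⟩ := Submodule.exists_mem_ne_zero_of_ne_bot hne
    obtain ⟨i, hi⟩ : ∃ i, w (coordIdx I i) ≠ 0 := by
      by_contra! hall
      apply hw0
      rw [sum_coordIdx I w]
      exact Finset.sum_eq_zero fun i _ => by rw [hall i, hwI i, zero_smul, zero_smul, add_zero]
    -- Isotropy enters here: `B x w = 0` together with `w (coordIdx I i) ≠ 0` forces the new
    -- coordinate of `x` to vanish, so exchanging `e_i` and `f_i` cannot enlarge the intersection.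
    have hflip : W ⊓ coordSubspace (I ∆ {i}) =
        (W ⊓ coordSubspace I) ⊓ LinearMap.ker (LinearMap.proj (coordIdx I i)) := by
      ext x
      simp only [Submodule.mem_inf, LinearMap.mem_ker, LinearMap.proj_apply]
      have hidx : coordIdx (I ∆ {i})ᶜ i = coordIdx I i :=
        coordIdx_congr (by simp)
      have hidx' (k : Fin n) (hk : k ≠ i) : coordIdx (I ∆ {i})ᶜ k = coordIdx Iᶜ k :=
        coordIdx_congr (by simp [hk])
      constructor
      · rintro ⟨hxW, hx⟩
        obtain ⟨ε, hε, hBx⟩ := hB hwI hx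
        rw [hW x hxW w hwW] at hBx
        refine ⟨⟨hxW, fun k => ?_⟩, ?_⟩
        · by_cases hk : k = i
          · subst hk
            simpa [hε, hi] using hBx.symm
          · rw [← hidx' k hk]
            exact hx k
        · rw [← hidx]
          exact hx i
      · rintro ⟨⟨hxW, hx⟩, hxi⟩
        refine ⟨hxW, fun k => ?_⟩
        by_cases hk : k = i
        · subst hk
          rw [hidx]
          exact hxi
        · rw [hidx' k hk]
          exact hx k
    have hfin := finrank_inf_ker_add_one (N := W ⊓ coordSubspace I)
      (LinearMap.proj (coordIdx I i)) ⟨hwW, hwI⟩ hi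
    rw [← hflip, hI] at hfin
    obtain ⟨I', h1, h2⟩ := ih (I ∆ {i}) (by omega)
    refine ⟨I', h1, h2.trans ?_⟩
    -- Each exchange lowers the dimension by one and changes the cardinality of the index by one, so
    -- the parity of their sum is invariant.
    have := card_symmDiff_singleton I i
    unfold Nat.ModEq
    omega

/-- A subspace transverse to `coordSubspace I` is a graph over the opposite coordinate subspace. -/
theorem exists_graph {W : Submodule ℂ (Fin (n + n) → ℂ)} (hW : Module.finrank ℂ W = n)
    {I : Finset (Fin n)} (hI : W ⊓ coordSubspace I = ⊥) :
    ∃ w : Fin n → (Fin (n + n) → ℂ), (∀ j, w j ∈ W) ∧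
      (∀ i j, w j (coordIdx Iᶜ i) = if i = j then 1 else 0) ∧
      ∀ v ∈ W, v = ∑ i, v (coordIdx Iᶜ i) • w i := by
  let f : W →ₗ[ℂ] (Fin n → ℂ) :=
    (LinearMap.pi fun i => LinearMap.proj (coordIdx Iᶜ i)).comp W.subtype
  have hf : Function.Injective f := by
    rw [← LinearMap.ker_eq_bot, LinearMap.ker_eq_bot']
    rintro ⟨v, hv⟩ h0
    have : v ∈ W ⊓ coordSubspace I := ⟨hv, fun i => congrFun h0 i⟩
    rw [hI, Submodule.mem_bot] at this
    exact Subtype.ext this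
  let e := LinearMap.linearEquivOfInjective f hf (by rw [hW]; simp)
  have he (x : W) (i : Fin n) : e x i = (x : Fin (n + n) → ℂ) (coordIdx Iᶜ i) := rfl
  let b := Module.Basis.ofEquivFun e
  refine ⟨fun j => b j, fun j => (b j).2, fun i j => ?_, fun v hv => ?_⟩
  · change (b j : Fin (n + n) → ℂ) (coordIdx Iᶜ i) = _
    rw [← he]
    simp [b, Pi.single_apply]
  · have := congrArg (W.subtype) (b.sum_repr ⟨v, hv⟩)
    simp only [map_sum, map_smul, Submodule.subtype_apply] at this
    exact this.symm

end Coordinate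

/-! ### Osculating projections in the Plücker embeddings -/

section PluckerProjections

variable {n : ℕ}

/-- The equations of the graph spanned by `w` over the coordinate subspace opposite to
`coordSubspace I`. -/
def graphEquation (I : Finset (Fin n)) (w : Fin n → (Fin (n + n) → ℂ)) (i : Fin n) :
    (Fin (n + n) → ℂ) →ₗ[ℂ] ℂ :=
  LinearMap.proj (coordIdx I i) -
    ∑ k, w k (coordIdx I i) • LinearMap.proj (coordIdx Iᶜ k)

theorem graphEquation_apply (I : Finset (Fin n)) (w : Fin n → (Fin (n + n) → ℂ)) (i : Fin n)
    (v : Fin (n + n) → ℂ) :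
    graphEquation I w i v = (v - ∑ k, v (coordIdx Iᶜ k) • w k) (coordIdx I i) := by
  simp [graphEquation, Finset.sum_apply, mul_comm]

/-- Subtracting from `v` the element of the graph with the same coordinates on the opposite subspace
leaves a vector of `coordSubspace I`, with the graph equations as its coordinates. -/
theorem graphEquation_dual {I : Finset (Fin n)} {w : Fin n → (Fin (n + n) → ℂ)}
    (hw : ∀ i j, w j (coordIdx Iᶜ i) = if i = j then 1 else 0) (v : Fin (n + n) → ℂ) :
    v = ∑ i, (graphEquation I w i v • Pi.single (coordIdx I i) (1 : ℂ) +
      LinearMap.proj (R := ℂ) (φ := fun _ => ℂ) (coordIdx Iᶜ i) v • w i) := by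
  have h := sum_coordIdx I (v - ∑ k, v (coordIdx Iᶜ k) • w k)
  have h0 (i : Fin n) : (v - ∑ k, v (coordIdx Iᶜ k) • w k) (coordIdx Iᶜ i) = 0 := by
    simp [Finset.sum_apply, hw]
  simp only [h0, zero_smul, add_zero, ← graphEquation_apply] at h
  rw [Finset.sum_add_distrib, ← h]
  simp

theorem graphEquation_single (I : Finset (Fin n)) (w : Fin n → (Fin (n + n) → ℂ)) (i j : Fin n) :
    graphEquation I w i (Pi.single (coordIdx I j) 1) = if i = j then 1 else 0 := by
  rw [graphEquation_apply]
  simp [Pi.single_apply, (coordIdx_injective I).eq_iff, coordIdx_compl_ne]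

/-- The matrix expresses the `w₀ j` in terms of the `w i`; if it were singular, the Plücker vector
of `w₀` would vanish. This supplies the reference chart `r` around the base point. -/
theorem det_chart_ne_zero {W : Submodule ℂ (Fin (n + n) → ℂ)} {I : Finset (Fin n)}
    {w w₀ : Fin n → (Fin (n + n) → ℂ)} (hW : ∀ v ∈ W, v = ∑ i, v (coordIdx Iᶜ i) • w i)
    (hw₀ : ∀ j, w₀ j ∈ W) (h : pluckerVector w₀ ≠ 0) :
    Matrix.det (Matrix.of fun i j => LinearMap.proj (R := ℂ) (φ := fun _ => ℂ)
      (coordIdx Iᶜ i) (w₀ j)) ≠ 0 := by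
  intro h0
  apply h
  have h1 := pluckerVector_sum_smul w (Matrix.of fun i j => LinearMap.proj (R := ℂ)
    (φ := fun _ => ℂ) (coordIdx Iᶜ i) (w₀ j))
  rw [h0, zero_smul] at h1
  rw [← h1]
  congr 1
  ext1 j
  exact hW _ (hw₀ j)

/-- Projections from osculating spaces of order at most `n - 2` at a subspace transverse to a
coordinate subspace of the family. -/
theorem projectionIsBirational_of_transverse {S : Set (Submodule ℂ (Fin (n + n) → ℂ))} {s : ℕ}
    (hs : s + 2 ≤ n) {W : Submodule ℂ (Fin (n + n) → ℂ)} (hWn : Module.finrank ℂ W = n)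
    {w₀ : Fin n → (Fin (n + n) → ℂ)} (hw₀W : ∀ j, w₀ j ∈ W) (hw₀ : pluckerVector w₀ ≠ 0)
    {T : Submodule ℂ (PluckerIndex n → ℂ)}
    (hT : IsOsculatingSpace (pluckerImage S) (Projectivization.mk ℂ _ hw₀) s T)
    {I : Finset (Fin n)} (hI : W ⊓ coordSubspace I = ⊥) (hIS : coordSubspace I ∈ S) :
    ProjectionIsBirational (linearSpan (pluckerImage S)) (pluckerImage S) T := by
  obtain ⟨w, -, hwδ, hwv⟩ := exists_graph hWn hI
  have hq (i j) : graphEquation I w i (w₀ j) = 0 := by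
    rw [graphEquation_apply, ← hwv _ (hw₀W j), sub_self, Pi.zero_apply]
  refine projectionIsBirational_pluckerImage hw₀ hT (graphEquation_dual hwδ)
    (det_chart_ne_zero hwv hw₀W hw₀) ⟨Finset.univ, ?_, fun i _ j => hq i j⟩
    (fun l k => ⟨Finset.univ.erase l, ?_, fun i hi j => ?_⟩) hIS (coordBasis I) ?_
  · simp
    omega
  · rw [Finset.card_erase_of_mem (Finset.mem_univ l)]
    simp
    omega
  · rw [Function.update_of_ne (Finset.ne_of_mem_erase hi), hq]
  · have h1 : (Matrix.of fun i j => graphEquation I w i (coordBasis I j)) = 1 := by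
      ext i j
      rw [Matrix.of_apply, coe_coordBasis, graphEquation_single, Matrix.one_apply]
    rw [h1, Matrix.det_one]
    exact one_ne_zero

/-- Projections from osculating spaces of order at most `n - 3` at a subspace transverse to a
neighbour of a coordinate subspace of the family. -/
theorem projectionIsBirational_of_transverse_neighbour
    {S : Set (Submodule ℂ (Fin (n + n) → ℂ))} {s : ℕ}
    (hs : s + 3 ≤ n) {W : Submodule ℂ (Fin (n + n) → ℂ)} (hWn : Module.finrank ℂ W = n)
    {w₀ : Fin n → (Fin (n + n) → ℂ)} (hw₀W : ∀ j, w₀ j ∈ W) (hw₀ : pluckerVector w₀ ≠ 0)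
    {T : Submodule ℂ (PluckerIndex n → ℂ)}
    (hT : IsOsculatingSpace (pluckerImage S) (Projectivization.mk ℂ _ hw₀) s T)
    {I : Finset (Fin n)} (hI : W ⊓ coordSubspace I = ⊥) {l : Fin n}
    (hIS : coordSubspace (I ∆ {l}) ∈ S) :
    ProjectionIsBirational (linearSpan (pluckerImage S)) (pluckerImage S) T := by
  obtain ⟨w, -, hwδ, hwv⟩ := exists_graph hWn hI
  have hq (i j) : graphEquation I w i (w₀ j) = 0 := by
    rw [graphEquation_apply, ← hwv _ (hw₀W j), sub_self, Pi.zero_apply]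
  let x : Fin n → (Fin (n + n) → ℂ) →ₗ[ℂ] ℂ := fun i => LinearMap.proj (coordIdx Iᶜ i)
  let u : Fin n → (Fin (n + n) → ℂ) := fun i => Pi.single (coordIdx I i) 1
  -- The `l`-th graph equation and the `l`-th coordinate exchange roles, and so do the dual basis
  -- vectors, so that the chart contains the neighbour `coordSubspace (I ∆ {l})`.
  refine projectionIsBirational_pluckerImage hw₀ hT
    (a := Function.update (graphEquation I w) l (x l))
    (c := Function.update x l (graphEquation I w l))
    (b := Function.update u l (w l)) (d := Function.update w l (u l)) (fun v => ?_)
    (det_chart_ne_zero hwv hw₀W hw₀) ⟨Finset.univ.erase l, ?_, fun i hi j => ?_⟩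
    (fun m k => ⟨(Finset.univ.erase l).erase m, ?_, fun i hi j => ?_⟩) hIS
    (coordBasis (I ∆ {l})) ?_
  · refine (graphEquation_dual hwδ v).trans (Finset.sum_congr rfl fun i _ => ?_)
    by_cases hi : i = l
    · subst hi
      simp only [Function.update_self]
      exact add_comm _ _
    · simp only [Function.update_of_ne hi]
      rfl
  · rw [Finset.card_erase_of_mem (Finset.mem_univ l)]
    simp
    omega
  · rw [Function.update_of_ne (Finset.ne_of_mem_erase hi), hq]
  · have := Finset.pred_card_le_card_erase (s := Finset.univ.erase l) (a := m)
    rw [Finset.card_erase_of_mem (Finset.mem_univ l)] at this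
    simp at this
    omega
  · have him := Finset.ne_of_mem_erase hi
    have hil := Finset.ne_of_mem_erase (Finset.mem_of_mem_erase hi)
    rw [Function.update_of_ne him, Function.update_of_ne hil, hq]
  · have h1 : (Matrix.of fun i j => Function.update (graphEquation I w) l (x l) i
        (coordBasis (I ∆ {l}) j)) = (1 : Matrix (Fin n) (Fin n) ℂ).updateCol l
        (fun i => Function.update (graphEquation I w) l (x l) i
          (Pi.single (coordIdx Iᶜ l) 1)) := by
      ext i j
      rw [Matrix.of_apply, coe_coordBasis]
      by_cases hj : j = l
      · subst hj
        rw [Matrix.updateCol_self, coordIdx_congr (I := I ∆ {j}) (J := Iᶜ)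
          (by rw [mem_symmDiff_singleton_self, Finset.mem_compl])]
      · rw [Matrix.updateCol_ne hj, Matrix.one_apply,
          coordIdx_congr (mem_symmDiff_singleton_of_ne (I := I) hj)]
        by_cases hi : i = l
        · subst hi
          rw [Function.update_self, if_neg (Ne.symm hj)]
          exact Pi.single_eq_of_ne (coordIdx_compl_ne _ _ _) _
        · rw [Function.update_of_ne hi, graphEquation_single]
    rw [h1, ← Matrix.cramer_apply, Matrix.cramer_one]
    simp [x]

theorem projectionIsBirational_lagrangianGrassmannian {s : ℕ} (hs : s + 2 ≤ n)
    {p : ℙ ℂ (PluckerIndex n → ℂ)} (hp : p ∈ lagrangianGrassmannian n)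
    {T : Submodule ℂ (PluckerIndex n → ℂ)}
    (hT : IsOsculatingSpace (lagrangianGrassmannian n) p s T) :
    ProjectionIsBirational (linearSpan (lagrangianGrassmannian n)) (lagrangianGrassmannian n)
      T := by
  obtain ⟨W, ⟨hWn, hW⟩, b, hb, rfl⟩ := hp
  obtain ⟨I, hI, -⟩ := exists_coordSubspace_inf_eq_bot sympForm_of_mem_coordSubspace hW _
    Finset.univ rfl
  exact projectionIsBirational_of_transverse hs hWn (fun j => (b j).2) hb hT hI
    (coordSubspace_mem_lagrangianSubspaces I)

/-- The transverse index satisfies `I.card ≡ n + dim (W ∩ baseSubspace n) ≡ 2 n`, so it is even.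
Hence `coordSubspace I` is in the family exactly when `n` is even; for `n` odd a neighbour is, and
the bound becomes `n - 3`. -/
theorem projectionIsBirational_spinorPlucker {s : ℕ} (hs : s + 2 ≤ 2 * (n / 2))
    {p : ℙ ℂ (PluckerIndex n → ℂ)} (hp : p ∈ spinorPlucker n)
    {T : Submodule ℂ (PluckerIndex n → ℂ)}
    (hT : IsOsculatingSpace (spinorPlucker n) p s T) :
    ProjectionIsBirational (linearSpan (spinorPlucker n)) (spinorPlucker n) T := by
  obtain ⟨W, ⟨hWn, hW, hWb⟩, b, hb, rfl⟩ := hp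
  obtain ⟨I, hI, hIc⟩ := exists_coordSubspace_inf_eq_bot quadForm_of_mem_coordSubspace hW _
    Finset.univ rfl
  rw [← baseSubspace_eq, Finset.card_univ, Fintype.card_fin] at hIc
  unfold Nat.ModEq at hWb hIc
  rcases Nat.even_or_odd n with hn | hn
  · refine projectionIsBirational_of_transverse (by omega) hWn (fun j => (b j).2) hb hT hI
      (coordSubspace_mem_spinorSubspaces ?_)
    rw [Nat.even_iff] at hn
    unfold Nat.ModEq
    omega
  · rw [Nat.odd_iff] at hn
    refine projectionIsBirational_of_transverse_neighbour (l := ⟨0, by omega⟩) (by omega) hWn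
      (fun j => (b j).2) hb hT hI (coordSubspace_mem_spinorSubspaces ?_)
    have := card_symmDiff_singleton I ⟨0, by omega⟩
    unfold Nat.ModEq
    omega

end PluckerProjections

/-! ### Clifford multiplication and pure spinors -/

section Spinors

variable {n : ℕ}

/-- The sign of the action of the `i`-th generators on the coordinate indexed by `I`. -/
def koszulSign (I : Finset (Fin n)) (i : Fin n) : ℂ := (-1) ^ (I.filter (· < i)).card

theorem koszulSign_mul_self (I : Finset (Fin n)) (i : Fin n) :
    koszulSign I i * koszulSign I i = 1 := by
  unfold koszulSign
  rw [← mul_pow]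
  simp

theorem koszulSign_ne_zero (I : Finset (Fin n)) (i : Fin n) : koszulSign I i ≠ 0 :=
  left_ne_zero_of_mul_eq_one (koszulSign_mul_self I i)

theorem koszulSign_symmDiff_singleton (I : Finset (Fin n)) (i k : Fin n) :
    koszulSign (I ∆ {i}) k = koszulSign I k * if i < k then -1 else 1 := by
  unfold koszulSign
  split_ifs with h
  · have hf : (I ∆ {i}).filter (· < k) = (I.filter (· < k)) ∆ {i} := by
      ext j
      simp only [Finset.mem_filter, Finset.mem_symmDiff, Finset.mem_singleton]
      by_cases hj : j = i
      · subst hj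
        simp [h]
      · simp [hj]
    rw [hf]
    rcases card_symmDiff_singleton (I.filter (· < k)) i with h1 | h1
    · rw [← h1, pow_succ]
      ring
    · rw [h1, pow_succ]
  · rw [mul_one]
    congr 2
    ext j
    simp only [Finset.mem_filter, Finset.mem_symmDiff, Finset.mem_singleton]
    by_cases hj : j = i
    · subst hj
      simp [h]
    · simp [hj]

/-- Inserting and erasing `i` are both symmetric difference with `{i}`, so wedging and contracting
obey a single formula. -/
theorem cliffordMul_apply (v : Fin (n + n) → ℂ) (ψ : Finset (Fin n) → ℂ) (I : Finset (Fin n)) :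
    cliffordMul v ψ I =
      ∑ i, koszulSign I i * (v (coordIdx Iᶜ i) * ψ (I ∆ {i})) := by
  refine Finset.sum_congr rfl fun i _ => ?_
  unfold koszulSign
  by_cases h : i ∈ I
  · rw [if_pos h, symmDiff_singleton_of_mem h, coordIdx, if_neg (by simpa using h)]
  · rw [if_neg h, symmDiff_singleton_of_notMem h, coordIdx, if_pos (by simpa using h)]

/-- Clifford multiplication as a linear map on spinors. -/
def cliffordLin (v : Fin (n + n) → ℂ) : (Finset (Fin n) → ℂ) →ₗ[ℂ] (Finset (Fin n) → ℂ) where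
  toFun := cliffordMul v
  map_add' := fun ψ χ => by
    ext I
    simp only [cliffordMul_apply, Pi.add_apply, ← Finset.sum_add_distrib]
    exact Finset.sum_congr rfl fun i _ => by ring
  map_smul' := fun c ψ => by
    ext I
    simp only [cliffordMul_apply, Pi.smul_apply, smul_eq_mul, Finset.mul_sum, RingHom.id_apply]
    exact Finset.sum_congr rfl fun i _ => by ring

theorem cliffordLin_apply (v : Fin (n + n) → ℂ) (ψ : Finset (Fin n) → ℂ) :
    cliffordLin v ψ = cliffordMul v ψ := rfl

theorem cliffordLin_sub_smul (v w : Fin (n + n) → ℂ) (c : ℂ) (ψ : Finset (Fin n) → ℂ) :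
    cliffordLin (v - c • w) ψ = cliffordLin v ψ - c • cliffordLin w ψ := by
  ext I
  simp only [cliffordLin_apply, cliffordMul_apply, Pi.sub_apply, Pi.smul_apply, smul_eq_mul,
    Finset.mul_sum, ← Finset.sum_sub_distrib]
  exact Finset.sum_congr rfl fun i _ => by ring

theorem cliffordLin_smul (c : ℂ) (v : Fin (n + n) → ℂ) (ψ : Finset (Fin n) → ℂ) :
    cliffordLin (c • v) ψ = c • cliffordLin v ψ := by
  ext I
  simp only [cliffordLin_apply, cliffordMul_apply, Pi.smul_apply, smul_eq_mul, Finset.mul_sum]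
  exact Finset.sum_congr rfl fun i _ => by ring

/-- Off-diagonal terms cancel in pairs because toggling the smaller index changes the sign at the
larger one. The normalization is that `e_i` and `f_i` have anticommutator `1`, so there is no factor
`2`. -/
theorem cliffordLin_anticommute (v w : Fin (n + n) → ℂ) (ψ : Finset (Fin n) → ℂ) :
    cliffordLin v (cliffordLin w ψ) + cliffordLin w (cliffordLin v ψ) = quadForm v w • ψ := by
  ext H
  simp only [cliffordLin_apply, Pi.add_apply, Pi.smul_apply, smul_eq_mul]
  simp only [cliffordMul_apply, Finset.mul_sum]
  rw [Finset.sum_comm (f := fun i k => koszulSign H i * (w (coordIdx Hᶜ i) *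
    (koszulSign (H ∆ {i}) k * (v (coordIdx (H ∆ {i})ᶜ k) * ψ (H ∆ {i} ∆ {k}))))),
    ← Finset.sum_add_distrib, quadForm, Finset.sum_mul]
  refine Finset.sum_congr rfl fun i _ => ?_
  rw [← Finset.sum_add_distrib, Finset.sum_eq_single i]
  · have h1 : koszulSign (H ∆ {i}) i = koszulSign H i := by
      rw [koszulSign_symmDiff_singleton, if_neg (lt_irrefl i), mul_one]
    have h2 : H ∆ {i} ∆ {i} = H := symmDiff_symmDiff_cancel_right _ _
    have h3 : coordIdx (H ∆ {i})ᶜ i = coordIdx H i :=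
      coordIdx_congr (by simp)
    have h4 := koszulSign_mul_self H i
    rw [h1, h2, h3]
    have h5 : v (coordIdx Hᶜ i) * w (coordIdx H i) + w (coordIdx Hᶜ i) * v (coordIdx H i) =
        v (Fin.castAdd n i) * w (Fin.natAdd n i) + v (Fin.natAdd n i) * w (Fin.castAdd n i) := by
      by_cases hi : i ∈ H <;> simp only [coordIdx, Finset.mem_compl, hi, not_true, not_false_iff,
        if_true, if_false] <;> ring
    rw [← h5]
    linear_combination (v (coordIdx Hᶜ i) * w (coordIdx H i) +
      w (coordIdx Hᶜ i) * v (coordIdx H i)) * ψ H * h4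
  · intro k _ hk
    have h1 : coordIdx (H ∆ {i})ᶜ k = coordIdx Hᶜ k := coordIdx_congr (by simp [hk])
    have h2 : coordIdx (H ∆ {k})ᶜ i = coordIdx Hᶜ i := coordIdx_congr (by simp [Ne.symm hk])
    have h3 : H ∆ {k} ∆ {i} = H ∆ {i} ∆ {k} := symmDiff_right_comm _ _ _
    rw [h1, h2, h3, koszulSign_symmDiff_singleton, koszulSign_symmDiff_singleton]
    rcases lt_or_gt_of_ne hk with h | h
    · rw [if_pos h, if_neg h.not_gt]
      ring
    · rw [if_pos h, if_neg h.not_gt]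
      ring
  · simp

/-- Spinors annihilated by a subspace of dimension `n`. -/
def IsPure (ψ : Finset (Fin n) → ℂ) : Prop :=
  ∃ W : Submodule ℂ (Fin (n + n) → ℂ), Module.finrank ℂ W = n ∧ ∀ w ∈ W, cliffordMul w ψ = 0

/-- The sign in the quadratic relations between the coordinates of a pure spinor. -/
def relationSign (J K : Finset (Fin n)) (i k : Fin n) : ℂ :=
  koszulSign (K ∆ {i}) i * koszulSign (K ∆ {i}) k * koszulSign (J ∆ {k}) k * koszulSign (J ∆ {k}) i

/-- The quadratic relations between the coordinates of a pure spinor. -/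
theorem IsPure.mul_eq_sum {ψ : Finset (Fin n) → ℂ} (hψ : IsPure ψ) {J K : Finset (Fin n)}
    (hJ : ψ J ≠ 0) {i : Fin n} (hi : i ∈ K ∆ J) :
    ψ J * ψ K = ∑ k ∈ (K ∆ J).erase i,
      relationSign J K i k * (ψ (J ∆ {k} ∆ {i}) * ψ (K ∆ {i} ∆ {k})) := by
  obtain ⟨W, hWn, hW⟩ := hψ
  have hidx (L : Finset (Fin n)) (k : Fin n) : coordIdx (L ∆ {k})ᶜ k = coordIdx L k :=
    coordIdx_congr (by simp)
  have hidx' (L : Finset (Fin n)) {k l : Fin n} (h : l ≠ k) :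
      coordIdx (L ∆ {k})ᶜ l = coordIdx Lᶜ l := coordIdx_congr (by simp [h])
  have hcancel (L : Finset (Fin n)) (k : Fin n) : L ∆ {k} ∆ {k} = L :=
    symmDiff_symmDiff_cancel_right _ _
  -- This is the component at `L ∆ {k}` of the equation `w · ψ = 0`, with the summand containing `ψ
  -- L` isolated.
  have hat (L : Finset (Fin n)) (k : Fin n) (w) (hw : w ∈ W) :
      koszulSign (L ∆ {k}) k * (w (coordIdx L k) * ψ L) + ∑ l ∈ Finset.univ.erase k,
        koszulSign (L ∆ {k}) l * (w (coordIdx Lᶜ l) * ψ (L ∆ {k} ∆ {l})) = 0 := by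
    have h := congrFun (hW w hw) (L ∆ {k})
    rw [cliffordMul_apply, ← Finset.add_sum_erase _ _ (Finset.mem_univ k), hidx, hcancel] at h
    rw [Pi.zero_apply] at h
    rw [← h]
    congr 1
    exact Finset.sum_congr rfl fun l hl => by rw [hidx' _ (Finset.ne_of_mem_erase hl)]
  -- For `w` in the intersection only the isolated summand is left, and `ψ J ≠ 0`. Hence `W` is a
  -- graph over the opposite coordinate subspace.
  have htr : W ⊓ coordSubspace J = ⊥ := by
    rw [Submodule.eq_bot_iff]
    rintro w ⟨hw, hwJ⟩
    have h0 (k : Fin n) : w (coordIdx J k) = 0 := by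
      have h := hat J k w hw
      rw [Finset.sum_eq_zero fun l _ => by rw [hwJ l, zero_mul, mul_zero], add_zero] at h
      simpa [koszulSign_ne_zero, hJ] using h
    rw [sum_coordIdx J w]
    exact Finset.sum_eq_zero fun k _ => by rw [h0, hwJ k, zero_smul, zero_smul, add_zero]
  obtain ⟨w, hwW, hwδ, -⟩ := exists_graph hWn htr
  -- The entries of the graph matrix are, up to sign, the ratios of the coordinates at `J ∆ {k} ∆
  -- {i}` and `J`. Substituting them into the component at `K ∆ {i}` gives the relation.
  have hcoef (k : Fin n) (hk : k ≠ i) : w i (coordIdx J k) * ψ J =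
      -(koszulSign (J ∆ {k}) k * koszulSign (J ∆ {k}) i * ψ (J ∆ {k} ∆ {i})) := by
    have h := hat J k (w i) (hwW i)
    rw [Finset.sum_eq_single_of_mem i (by simp [Ne.symm hk]) fun l _ hl => by
      rw [hwδ, if_neg hl, zero_mul, mul_zero], hwδ, if_pos rfl] at h
    have h2 := koszulSign_mul_self (J ∆ {k}) k
    linear_combination koszulSign (J ∆ {k}) k * h - w i (coordIdx J k) * ψ J * h2
  have hK := hat K i (w i) (hwW i)
  have hKi : coordIdx K i = coordIdx Jᶜ i := coordIdx_congr (by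
    rw [Finset.mem_symmDiff] at hi
    rw [Finset.mem_compl]
    tauto)
  rw [hKi, hwδ, if_pos rfl, one_mul,
    ← Finset.sum_subset (Finset.erase_subset_erase i (Finset.subset_univ (K ∆ J)))] at hK
  · have h2 := koszulSign_mul_self (K ∆ {i}) i
    have hsum : ∑ k ∈ (K ∆ J).erase i,
        relationSign J K i k * (ψ (J ∆ {k} ∆ {i}) * ψ (K ∆ {i} ∆ {k})) =
        -(koszulSign (K ∆ {i}) i * ψ J * ∑ k ∈ (K ∆ J).erase i,
          koszulSign (K ∆ {i}) k * (w i (coordIdx Kᶜ k) * ψ (K ∆ {i} ∆ {k}))) := by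
      rw [Finset.mul_sum, ← Finset.sum_neg_distrib]
      refine Finset.sum_congr rfl fun k hk => ?_
      have hkK := Finset.mem_of_mem_erase hk
      have hidxk : coordIdx Kᶜ k = coordIdx J k := coordIdx_congr (by
        rw [Finset.mem_symmDiff] at hkK
        rw [Finset.mem_compl]
        tauto)
      rw [hidxk]
      have h3 := hcoef k (Finset.ne_of_mem_erase hk)
      unfold relationSign
      linear_combination (koszulSign (K ∆ {i}) i * koszulSign (K ∆ {i}) k *
        ψ (K ∆ {i} ∆ {k})) * h3
    rw [hsum]
    linear_combination koszulSign (K ∆ {i}) i * ψ J * hK - ψ J * ψ K * h2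
  · intro l hl hl'
    have hli := Finset.ne_of_mem_erase hl
    have hlK : l ∉ K ∆ J := fun h => hl' (Finset.mem_erase.2 ⟨hli, h⟩)
    have hidxl : coordIdx Kᶜ l = coordIdx Jᶜ l := coordIdx_congr (by
      rw [Finset.mem_symmDiff] at hlK
      rw [Finset.mem_compl, Finset.mem_compl]
      tauto)
    rw [hidxl, hwδ, if_neg hli, zero_mul, mul_zero]

end Spinors

/-! ### Linear symmetries of the set of pure spinors -/

section Symmetries

variable {n : ℕ}

/-- Spinors in the even half-spin representation. -/
def IsEvenSpinor (ψ : Finset (Fin n) → ℂ) : Prop :=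
  ∀ H : Finset (Fin n), ¬ Even H.card → ψ H = 0

/-- A linear automorphism preserving pure spinors whose inverse preserves even spinors. -/
structure IsSpinorSymmetry (g : (Finset (Fin n) → ℂ) ≃ₗ[ℂ] (Finset (Fin n) → ℂ)) : Prop where
  isPure : ∀ ψ, IsPure ψ → IsPure (g ψ)
  isEvenSpinor_symm : ∀ ψ, IsEvenSpinor ψ → IsEvenSpinor (g.symm ψ)

theorem IsSpinorSymmetry.trans {g h : (Finset (Fin n) → ℂ) ≃ₗ[ℂ] (Finset (Fin n) → ℂ)}
    (hg : IsSpinorSymmetry g) (hh : IsSpinorSymmetry h) : IsSpinorSymmetry (g.trans h) :=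
  ⟨fun ψ hψ => hh.isPure _ (hg.isPure ψ hψ),
    fun ψ hψ => hg.isEvenSpinor_symm _ (hh.isEvenSpinor_symm ψ hψ)⟩

/-- The quadratic form as a bilinear map. -/
def quadBilin : (Fin (n + n) → ℂ) →ₗ[ℂ] (Fin (n + n) → ℂ) →ₗ[ℂ] ℂ :=
  LinearMap.mk₂ ℂ quadForm
    (fun u v w => by
      simp only [quadForm, Pi.add_apply, ← Finset.sum_add_distrib]
      exact Finset.sum_congr rfl fun i _ => by ring)
    (fun c u v => by
      simp only [quadForm, Pi.smul_apply, smul_eq_mul, Finset.mul_sum]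
      exact Finset.sum_congr rfl fun i _ => by ring)
    (fun u v w => by
      simp only [quadForm, Pi.add_apply, ← Finset.sum_add_distrib]
      exact Finset.sum_congr rfl fun i _ => by ring)
    (fun c u v => by
      simp only [quadForm, Pi.smul_apply, smul_eq_mul, Finset.mul_sum]
      exact Finset.sum_congr rfl fun i _ => by ring)

theorem quadBilin_apply (v w : Fin (n + n) → ℂ) : quadBilin v w = quadForm v w := rfl

theorem quadForm_comm (v w : Fin (n + n) → ℂ) : quadForm v w = quadForm w v :=
  Finset.sum_congr rfl fun i _ => by ring

section Elementary

variable {u v : Fin (n + n) → ℂ}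

theorem cliffordLin_cliffordLin_self (hu : quadForm u u = 0) (ψ : Finset (Fin n) → ℂ) :
    cliffordLin u (cliffordLin u ψ) = 0 := by
  have h := cliffordLin_anticommute u u ψ
  rw [hu, zero_smul, ← two_smul ℂ] at h
  exact (smul_eq_zero.1 h).resolve_left two_ne_zero

theorem cliffordLin_comm (huv : quadForm u v = 0) (ψ : Finset (Fin n) → ℂ) :
    cliffordLin v (cliffordLin u ψ) = -cliffordLin u (cliffordLin v ψ) := by
  have h := cliffordLin_anticommute u v ψ
  rw [huv, zero_smul] at h
  exact eq_neg_of_add_eq_zero_right h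

/-- The automorphism `1 + c u v` of the spin representation. -/
def elementary (hu : quadForm u u = 0) (huv : quadForm u v = 0) (c : ℂ) :
    (Finset (Fin n) → ℂ) ≃ₗ[ℂ] (Finset (Fin n) → ℂ) :=
  have h (ψ : Finset (Fin n) → ℂ) :
      cliffordLin u (cliffordLin v (cliffordLin u (cliffordLin v ψ))) = 0 := by
    rw [cliffordLin_comm huv, map_neg, cliffordLin_cliffordLin_self hu, neg_zero]
  LinearEquiv.ofLinearMap (LinearMap.id + c • (cliffordLin u ∘ₗ cliffordLin v))
    (LinearMap.id - c • (cliffordLin u ∘ₗ cliffordLin v))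
    (LinearMap.ext fun ψ => by simp [h])
    (LinearMap.ext fun ψ => by simp [h])

theorem elementary_apply (hu : quadForm u u = 0) (huv : quadForm u v = 0) (c : ℂ)
    (ψ : Finset (Fin n) → ℂ) :
    elementary hu huv c ψ = ψ + c • cliffordMul u (cliffordMul v ψ) := rfl

theorem elementary_symm_apply (hu : quadForm u u = 0) (huv : quadForm u v = 0) (c : ℂ)
    (ψ : Finset (Fin n) → ℂ) :
    (elementary hu huv c).symm ψ = ψ - c • cliffordMul u (cliffordMul v ψ) := rfl

/-- The corresponding transformation of vectors is `η = 1 - c θ`, where `θ w = q(u, w) v - q(v, w)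
u`. It is injective because `θ ∘ θ = 0`, and the Clifford relations show that `η w` annihilates `(1
+ c u v) ψ` whenever `w` annihilates `ψ`. -/
theorem IsPure.elementary (hu : quadForm u u = 0) (hv : quadForm v v = 0)
    (huv : quadForm u v = 0) (c : ℂ) {ψ : Finset (Fin n) → ℂ} (hψ : IsPure ψ) :
    IsPure (elementary hu huv c ψ) := by
  obtain ⟨W, hWn, hW⟩ := hψ
  let θ : (Fin (n + n) → ℂ) →ₗ[ℂ] (Fin (n + n) → ℂ) :=
    (quadBilin u).smulRight v - (quadBilin v).smulRight u
  have hθ (w) : θ w = quadForm u w • v - quadForm v w • u := rfl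
  have hθu (w) : quadForm u (θ w) = 0 := by
    rw [← quadBilin_apply, hθ, map_sub, map_smul, map_smul, quadBilin_apply, quadBilin_apply,
      hu, huv]
    simp
  have hθv (w) : quadForm v (θ w) = 0 := by
    rw [← quadBilin_apply, hθ, map_sub, map_smul, map_smul, quadBilin_apply, quadBilin_apply,
      hv, quadForm_comm v u, huv]
    simp
  let η : (Fin (n + n) → ℂ) →ₗ[ℂ] (Fin (n + n) → ℂ) := LinearMap.id - c • θ
  have hinj : Function.Injective η := by
    rw [← LinearMap.ker_eq_bot, LinearMap.ker_eq_bot']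
    intro w hw
    have hw' : w = c • θ w := sub_eq_zero.1 hw
    have h0 : θ w = 0 := by
      rw [hw', map_smul, hθ (θ w), hθu, hθv]
      simp
    rw [hw', h0, smul_zero]
  refine ⟨W.map η, ?_, ?_⟩
  · rw [(Submodule.equivMapOfInjective _ hinj W).symm.finrank_eq, hWn]
  · rintro _ ⟨w, hw, rfl⟩
    have hwψ : cliffordLin w ψ = 0 := hW w hw
    have hwuv : cliffordLin w (cliffordLin u (cliffordLin v ψ)) =
        quadForm u w • cliffordLin v ψ - quadForm v w • cliffordLin u ψ := by
      have h1 := eq_sub_of_add_eq' (cliffordLin_anticommute u w (cliffordLin v ψ))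
      have h2 := eq_sub_of_add_eq' (cliffordLin_anticommute v w ψ)
      rw [h1, h2, hwψ, map_zero, sub_zero, map_smul]
    have hθψ (χ) : cliffordLin (θ w) χ =
        quadForm u w • cliffordLin v χ - quadForm v w • cliffordLin u χ := by
      rw [hθ, cliffordLin_sub_smul, cliffordLin_smul]
    have hη (χ) : cliffordLin (η w) χ = cliffordLin w χ - c • cliffordLin (θ w) χ :=
      cliffordLin_sub_smul w (θ w) c χ
    change cliffordLin (η w) (ψ + c • cliffordLin u (cliffordLin v ψ)) = 0
    rw [hη, map_add, map_add, map_smul, map_smul, hwψ, hwuv, hθψ, hθψ, cliffordLin_comm huv,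
      cliffordLin_cliffordLin_self hv, cliffordLin_cliffordLin_self hu]
    simp

end Elementary

/-- Clifford multiplication exchanges the two half-spin spaces; a Boolean parity allows it to be
applied twice in a row. -/
theorem cliffordMul_eq_zero_of_bodd {v : Fin (n + n) → ℂ} {b : Bool} {ψ : Finset (Fin n) → ℂ}
    (hψ : ∀ H : Finset (Fin n), H.card.bodd = b → ψ H = 0) (H : Finset (Fin n))
    (hH : H.card.bodd = !b) : cliffordMul v ψ H = 0 := by
  rw [cliffordMul_apply]
  refine Finset.sum_eq_zero fun i _ => ?_
  rw [hψ (H ∆ {i}), mul_zero, mul_zero]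
  rcases card_symmDiff_singleton H i with h | h
  · rw [← h, Nat.bodd_add] at hH
    simpa using hH
  · rw [h, Nat.bodd_add, hH]
    simp

theorem isEvenSpinor_iff {ψ : Finset (Fin n) → ℂ} :
    IsEvenSpinor ψ ↔ ∀ H : Finset (Fin n), H.card.bodd = true → ψ H = 0 := by
  refine forall_congr' fun H => ?_
  rw [Nat.not_even_iff_odd, Nat.odd_iff, Nat.mod_two_of_bodd]
  cases H.card.bodd <;> simp

theorem isSpinorSymmetry_elementary {u v : Fin (n + n) → ℂ} (hu : quadForm u u = 0)
    (hv : quadForm v v = 0) (huv : quadForm u v = 0) (c : ℂ) :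
    IsSpinorSymmetry (elementary hu huv c) := by
  refine ⟨fun ψ hψ => hψ.elementary hu hv huv c, fun ψ hψ => ?_⟩
  rw [isEvenSpinor_iff] at hψ ⊢
  intro H hH
  rw [elementary_symm_apply, Pi.sub_apply, Pi.smul_apply, hψ H hH,
    cliffordMul_eq_zero_of_bodd (b := false) (cliffordMul_eq_zero_of_bodd (b := true) hψ) H hH]
  simp

theorem cliffordMul_single (K : Finset (Fin n)) (i : Fin n) (ψ : Finset (Fin n) → ℂ)
    (H : Finset (Fin n)) : cliffordMul (Pi.single (coordIdx K i) 1) ψ H =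
      if i ∈ H ∆ K then koszulSign H i * ψ (H ∆ {i}) else 0 := by
  rw [cliffordMul_apply, Finset.sum_eq_single i]
  · have h : coordIdx Hᶜ i = coordIdx K i ↔ i ∈ H ∆ K := by
      rw [coordIdx_eq_iff, Finset.mem_symmDiff, Finset.mem_compl]
      tauto
    by_cases hi : i ∈ H ∆ K
    · rw [if_pos hi, h.2 hi, Pi.single_eq_same, one_mul]
    · rw [if_neg hi, Pi.single_eq_of_ne (fun h' => hi (h.1 h')), zero_mul, mul_zero]
  · intro j _ hj
    rw [Pi.single_eq_of_ne fun h => hj (coordIdx_eq_iff.1 h).1, zero_mul, mul_zero]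
  · simp

/-- Pure spinors can be moved to position where their second-order coordinates at a given index
of a nonzero coordinate vanish. -/
theorem exists_normalizing_symmetry (K : Finset (Fin n)) (N : ℕ) :
    ∀ ψ : Finset (Fin n) → ℂ, ψ K ≠ 0 →
      (Finset.univ.filter fun H : Finset (Fin n) => (H ∆ K).card = 2 ∧ ψ H ≠ 0).card = N →
      ∃ g, IsSpinorSymmetry g ∧ g ψ K ≠ 0 ∧ ∀ H, (H ∆ K).card = 2 → g ψ H = 0 := by
  induction N with
  | zero =>
    intro ψ hK hN
    refine ⟨LinearEquiv.refl ℂ _, ⟨fun _ h => h, fun _ h => h⟩, hK, fun H hH => ?_⟩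
    by_contra hne
    have : H ∈ Finset.univ.filter fun H : Finset (Fin n) => (H ∆ K).card = 2 ∧ ψ H ≠ 0 := by
      simpa using ⟨hH, hne⟩
    rw [Finset.card_eq_zero.1 hN] at this
    simp at this
  | succ N ih =>
    intro ψ hK hN
    have hpos : 0 < (Finset.univ.filter fun H : Finset (Fin n) =>
        (H ∆ K).card = 2 ∧ ψ H ≠ 0).card := by omega
    obtain ⟨H, hH⟩ := Finset.card_pos.1 hpos
    have hHN := hH
    rw [Finset.mem_filter] at hH
    obtain ⟨-, hH2, hH0⟩ := hH
    obtain ⟨i, k, hik, hHK⟩ := Finset.card_eq_two.1 hH2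
    have hiso (a b : Fin n) : quadForm (Pi.single (coordIdx K a) 1)
        (Pi.single (coordIdx K b) (1 : ℂ)) = 0 :=
      quadForm_eq_zero_of_mem_coordSubspace (single_mem_coordSubspace K a)
        (single_mem_coordSubspace K b)
    have hHik : H ∆ {i} ∆ {k} = K := by
      rw [symmDiff_assoc, symmDiff_singleton_of_notMem (I := {i}) (i := k) (by simpa using hik.symm),
        Finset.pair_comm, ← hHK, symmDiff_symmDiff_cancel_left]
    -- Here `u v` is a product of two basis vectors of `coordSubspace K` that carries the coordinate
    -- at `K` to the index `H = K ∆ {i, k}`; this value of `c` cancels `ψ H`.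
    set c := -ψ H / (koszulSign H i * koszulSign (H ∆ {i}) k * ψ K) with hc
    set τ := elementary (hiso i i) (hiso i k) c with hτ
    -- Only indices `H'` with both `i` and `k` in `H' ∆ K` are affected; among those at distance
    -- zero or two from `K`, this is `H` alone.
    have hval (H' : Finset (Fin n)) : τ ψ H' = ψ H' + c * (if i ∈ H' ∆ K then koszulSign H' i *
        (if k ∈ H' ∆ {i} ∆ K then koszulSign (H' ∆ {i}) k * ψ (H' ∆ {i} ∆ {k}) else 0)
        else 0) := by
      rw [hτ, elementary_apply, Pi.add_apply, Pi.smul_apply, cliffordMul_single,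
        cliffordMul_single, smul_eq_mul]
    have hτK : τ ψ K = ψ K := by
      rw [hval, symmDiff_self]
      simp
    have hτH : τ ψ H = 0 := by
      have h1 : k ∈ H ∆ {i} ∆ K := by
        rw [symmDiff_right_comm, hHK, mem_symmDiff_singleton_of_ne hik.symm]
        simp
      rw [hval, if_pos (by simp [hHK]), if_pos h1, hHik, hc]
      have := koszulSign_ne_zero H i
      have := koszulSign_ne_zero (H ∆ {i}) k
      field_simp
      ring
    have hτne (H' : Finset (Fin n)) (h2 : (H' ∆ K).card = 2) (hne : H' ≠ H) :
        τ ψ H' = ψ H' := by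
      rw [hval]
      split_ifs with h3 h4
      · exfalso
        apply hne
        rw [symmDiff_right_comm, mem_symmDiff_singleton_of_ne hik.symm] at h4
        have hsub : H ∆ K ⊆ H' ∆ K := by
          rw [hHK]
          intro j hj
          rcases Finset.mem_insert.1 hj with rfl | hj
          · exact h3
          · rwa [Finset.mem_singleton.1 hj]
        have heq := Finset.eq_of_subset_of_card_le hsub (by rw [h2, hH2])
        exact (symmDiff_left_injective K heq).symm
      · simp
      · simp
    have hset : (Finset.univ.filter fun H' : Finset (Fin n) =>
        (H' ∆ K).card = 2 ∧ τ ψ H' ≠ 0) = (Finset.univ.filter fun H' : Finset (Fin n) =>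
        (H' ∆ K).card = 2 ∧ ψ H' ≠ 0).erase H := by
      ext H'
      simp only [Finset.mem_filter, Finset.mem_univ, true_and, Finset.mem_erase]
      by_cases h : H' = H
      · subst h
        simp [hτH]
      · constructor
        · rintro ⟨h2, h3⟩
          rw [hτne H' h2 h] at h3
          exact ⟨h, h2, h3⟩
        · rintro ⟨-, h2, h3⟩
          rw [hτne H' h2 h]
          exact ⟨h2, h3⟩
    obtain ⟨g, hg, hgK, hg2⟩ := ih (τ ψ) (by rwa [hτK]) (by
      rw [hset, Finset.card_erase_of_mem hHN, hN]
      rfl)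
    exact ⟨τ.trans g, (isSpinorSymmetry_elementary _ (hiso k k) _ c).trans hg, hgK, hg2⟩

end Symmetries

/-! ### Osculating projections in the Spinor embedding -/

section SpinorProjections

variable {n : ℕ}

theorem card_symmDiff_pair_symmDiff {K J : Finset (Fin n)} {i k : Fin n} (hi : i ∈ K ∆ J)
    (hk : k ∈ (K ∆ J).erase i) : ((K ∆ {i} ∆ {k}) ∆ J).card + 2 = (K ∆ J).card := by
  rw [symmDiff_right_comm, symmDiff_right_comm K, symmDiff_singleton_of_mem hi,
    symmDiff_singleton_of_mem hk, ← Finset.card_erase_add_one hi, ← Finset.card_erase_add_one hk]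

theorem IsPure.apply_eq_zero_of_card_eq_one {ψ : Finset (Fin n) → ℂ} (hψ : IsPure ψ)
    {J K : Finset (Fin n)} (hJ : ψ J ≠ 0) (hK : (K ∆ J).card = 1) : ψ K = 0 := by
  obtain ⟨i, hi⟩ := Finset.card_eq_one.1 hK
  have h := hψ.mul_eq_sum hJ (K := K) (i := i) (by simp [hi])
  rw [hi, Finset.erase_singleton, Finset.sum_empty] at h
  exact (mul_eq_zero.1 h).resolve_left hJ

/-- The coordinates of a spinor with indices `J` and `J ∆ {i} ∆ {k}`. -/
def chartCoord (J : Finset (Fin n)) (o : Option (Fin n × Fin n)) : Finset (Fin n) :=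
  o.elim J fun q => J ∆ {q.1} ∆ {q.2}

/-- In a standard chart the coordinates of a pure spinor are polynomials in those of order at
most two. -/
theorem exists_recovery_polynomial (J : Finset (Fin n)) (m : ℕ) :
    ∀ K : Finset (Fin n), (K ∆ J).card = m →
      ∃ P : MvPolynomial (Option (Fin n × Fin n)) ℂ, P.IsHomogeneous (m / 2) ∧
        ∀ ψ : Finset (Fin n) → ℂ, IsPure ψ → ψ J ≠ 0 →
          ψ J * MvPolynomial.eval (fun o => ψ (chartCoord J o)) P = ψ J ^ (m / 2) * ψ K := by
  induction m using Nat.strong_induction_on with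
  | _ m ih =>
    intro K hK
    rcases Nat.lt_or_ge m 2 with hm | hm
    · interval_cases m
      · obtain rfl : K = J := symmDiff_eq_bot.1 (Finset.card_eq_zero.1 hK)
        exact ⟨1, MvPolynomial.isHomogeneous_one _ _, fun ψ _ _ => by simp⟩
      · refine ⟨0, MvPolynomial.isHomogeneous_zero _ _ _, fun ψ hψ hJ => ?_⟩
        rw [hψ.apply_eq_zero_of_card_eq_one hJ hK]
        simp
    · obtain ⟨i, hi⟩ : (K ∆ J).Nonempty := Finset.card_pos.1 (by omega)
      have hex (k : Fin n) (hk : k ∈ (K ∆ J).erase i) :=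
        ih (m - 2) (by omega) (K ∆ {i} ∆ {k}) (by
          have := card_symmDiff_pair_symmDiff hi hk
          omega)
      choose! P hPhom hP using hex
      have hm2 : m / 2 = 1 + (m - 2) / 2 := by omega
      -- This is the recursive expansion of a Pfaffian along `i`: the indices `K ∆ {i} ∆ {k}` are
      -- two steps closer to `J`.
      refine ⟨∑ k ∈ (K ∆ J).erase i, MvPolynomial.C (relationSign J K i k) *
        MvPolynomial.X (some (k, i)) * P k, ?_, fun ψ hψ hJ => ?_⟩
      · refine MvPolynomial.IsHomogeneous.sum _ _ _ fun k hk => ?_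
        rw [hm2]
        exact (MvPolynomial.isHomogeneous_C_mul_X _ _).mul (hPhom k hk)
      · rw [hm2, pow_add, pow_one, mul_assoc, mul_left_comm, hψ.mul_eq_sum hJ hi, map_sum,
          Finset.mul_sum, Finset.mul_sum]
        refine Finset.sum_congr rfl fun k hk => ?_
        simp only [map_mul, MvPolynomial.eval_C, MvPolynomial.eval_X]
        have h := hP k hk ψ hψ hJ
        simp only [chartCoord, Option.elim] at h ⊢
        linear_combination (relationSign J K i k * ψ (J ∆ {k} ∆ {i})) * h

/-- The coordinates of an analytic family of pure spinors vanish to order half of the distance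
from the index of the spinor at the origin. -/
theorem vanishesToOrder_of_isPure {m : ℕ} {χ : (Fin m → ℂ) → (Finset (Fin n) → ℂ)}
    (hχ : ∀ H, AnalyticAt ℂ (fun t => χ t H) 0) (hpure : ∀ᶠ t in 𝓝 0, IsPure (χ t))
    {K : Finset (Fin n)} (hK : χ 0 K ≠ 0) (hK2 : ∀ H, (H ∆ K).card = 2 → χ 0 H = 0) (r : ℕ) :
    ∀ H : Finset (Fin n), (H ∆ K).card = r → VanishesToOrder (fun t => χ t H) (r / 2) := by
  induction r using Nat.strong_induction_on with
  | _ r ih =>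
    intro H hH
    rcases Nat.lt_or_ge r 2 with hr | hr
    · rw [Nat.div_eq_of_lt hr]
      exact VanishesToOrder.of_analyticAt (hχ H)
    · obtain ⟨i, hi⟩ : (H ∆ K).Nonempty := Finset.card_pos.1 (by omega)
      -- Each summand is a coordinate at distance two from `K`, which vanishes at the origin by
      -- normalization, times a coordinate at distance `r - 2`, which vanishes to order `(r - 2) /
      -- 2` by induction.
      have hsum : VanishesToOrder (fun t => ∑ k ∈ (H ∆ K).erase i, relationSign K H i k *
          (χ t (K ∆ {k} ∆ {i}) * χ t (H ∆ {i} ∆ {k}))) (1 + (r - 2) / 2) := by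
        refine VanishesToOrder.sum _ fun k hk => VanishesToOrder.const_mul ?_ _
        refine (VanishesToOrder.of_apply_zero (hχ _) (hK2 _ ?_)).mul
          (ih (r - 2) (by omega) _ ?_)
        · rw [symmDiff_right_comm, symmDiff_right_comm K, symmDiff_self, bot_symmDiff,
            symmDiff_singleton_of_notMem]
          · exact Finset.card_pair (Finset.ne_of_mem_erase hk).symm
          · simpa using (Finset.ne_of_mem_erase hk).symm
        · have := card_symmDiff_pair_symmDiff hi hk
          omega
      have hinv : VanishesToOrder (fun t => (χ t K)⁻¹) 0 :=
        VanishesToOrder.of_analyticAt ((hχ K).inv hK)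
      have hm2 : r / 2 = 0 + (1 + (r - 2) / 2) := by omega
      rw [hm2]
      refine (hinv.mul hsum).congr ?_
      filter_upwards [hpure, (hχ K).continuousAt.eventually_ne hK] with t ht htK
      rw [← ht.mul_eq_sum htK hi, inv_mul_cancel_left₀ htK]

/-- The inclusion of the half-spin representation as a linear map. -/
def ofHalfSpinLin : (EvenSubset n → ℂ) →ₗ[ℂ] (Finset (Fin n) → ℂ) where
  toFun := ofHalfSpin
  map_add' := fun ψ χ => by
    ext H
    simp only [ofHalfSpin, Pi.add_apply]
    split_ifs <;> simp
  map_smul' := fun c ψ => by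
    ext H
    simp only [ofHalfSpin, Pi.smul_apply, RingHom.id_apply]
    split_ifs <;> simp

theorem ofHalfSpinLin_apply (ψ : EvenSubset n → ℂ) : ofHalfSpinLin ψ = ofHalfSpin ψ := rfl

theorem ofHalfSpinLin_coe (ψ : EvenSubset n → ℂ) (H : EvenSubset n) :
    ofHalfSpinLin ψ H = ψ H := by
  rw [ofHalfSpinLin_apply, ofHalfSpin, dif_pos H.2]

theorem IsEvenSpinor.exists_ofHalfSpinLin {ψ : Finset (Fin n) → ℂ} (hψ : IsEvenSpinor ψ) :
    ∃ χ, ofHalfSpinLin χ = ψ := by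
  refine ⟨fun H => ψ H, ?_⟩
  ext H
  rw [ofHalfSpinLin_apply, ofHalfSpin]
  split_ifs with h
  · rfl
  · exact (hψ H h).symm

theorem IsPure.smul {ψ : Finset (Fin n) → ℂ} (hψ : IsPure ψ) (c : ℂ) : IsPure (c • ψ) := by
  obtain ⟨W, hWn, hW⟩ := hψ
  refine ⟨W, hWn, fun w hw => ?_⟩
  rw [← cliffordLin_apply, map_smul, cliffordLin_apply, hW w hw, smul_zero]

theorem isPure_of_mem_spinorVariety {x : EvenSubset n → ℂ} (h : x ≠ 0)
    (hx : Projectivization.mk ℂ x h ∈ spinorVariety n) : IsPure (ofHalfSpinLin x) := by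
  obtain ⟨W, ⟨hWn, -⟩, hW⟩ := hx
  obtain ⟨c, hc, hrep⟩ := rep_eq_smul h rfl
  rw [hrep] at hW
  have hp : IsPure (ofHalfSpinLin (c • x)) := ⟨W, hWn, hW⟩
  have := hp.smul c⁻¹
  rwa [map_smul, smul_smul, inv_mul_cancel₀ hc, one_smul] at this

/-- The spinor `f_H` is killed by `f_i` for `i ∈ H` and by `e_i` for `i ∉ H`. These points span the
half-spin space, so a nonzero linear form cannot vanish on the whole variety. -/
theorem single_mem_spinorVariety (H : EvenSubset n) :
    ∃ h : (Pi.single H 1 : EvenSubset n → ℂ) ≠ 0,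
      Projectivization.mk ℂ (Pi.single H 1 : EvenSubset n → ℂ) h ∈ spinorVariety n := by
  have hne : (Pi.single H 1 : EvenSubset n → ℂ) ≠ 0 := by simp
  have hHc : (H : Finset (Fin n))ᶜ.card ≡ n [MOD 2] := by
    have h1 := Finset.card_add_card_compl (H : Finset (Fin n))
    rw [Fintype.card_fin] at h1
    have h2 := Nat.even_iff.1 H.2
    unfold Nat.ModEq
    omega
  refine ⟨hne, coordSubspace (H : Finset (Fin n))ᶜ, coordSubspace_mem_spinorSubspaces hHc,
    fun w hw => ?_⟩
  obtain ⟨c, hc, hrep⟩ := rep_eq_smul hne rfl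
  have hsingle : ofHalfSpinLin (Pi.single H 1 : EvenSubset n → ℂ) =
      Pi.single (H : Finset (Fin n)) 1 := by
    ext I
    rw [ofHalfSpinLin_apply, ofHalfSpin]
    split_ifs with hI
    · simp [Pi.single_apply, Subtype.ext_iff]
    · rw [Pi.single_eq_of_ne]
      rintro rfl
      exact hI H.2
  rw [hrep, ← ofHalfSpinLin_apply, map_smul, ← cliffordLin_apply, map_smul, hsingle,
    cliffordLin_apply]
  refine smul_eq_zero_of_right _ ?_
  ext I
  rw [cliffordMul_apply]
  refine Finset.sum_eq_zero fun i _ => ?_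
  by_cases h : I ∆ {i} = (H : Finset (Fin n))
  · have hi := hw i
    have hidx : coordIdx Iᶜ i = coordIdx (H : Finset (Fin n))ᶜᶜ i := by
      rw [← h, compl_compl]
      exact coordIdx_congr (by rw [Finset.mem_compl, mem_symmDiff_singleton_self])
    rw [hidx, hi, zero_mul, mul_zero]
  · rw [Pi.single_eq_of_ne h, mul_zero, mul_zero]

/-- An even index far from a given one. -/
theorem exists_far_index {s : ℕ} (hs : s + 2 ≤ n / 2) {K : Finset (Fin n)} (hK : Even K.card) :
    ∃ J : Finset (Fin n), Even J.card ∧ ∀ o, s + 1 ≤ (chartCoord J o ∆ K).card / 2 := by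
  have hcompl := Finset.card_add_card_compl K
  rw [Fintype.card_fin] at hcompl
  -- Toggling two elements lowers the distance to `K` by at most two, from `2 * s + 4` to `2 * s +
  -- 2`.
  have hle (J : Finset (Fin n)) (hJ : 2 * s + 4 ≤ (J ∆ K).card) (o) :
      s + 1 ≤ (chartCoord J o ∆ K).card / 2 := by
    rcases o with _ | ⟨i, k⟩
    · simp only [chartCoord, Option.elim]
      omega
    · simp only [chartCoord, Option.elim]
      rw [symmDiff_right_comm, symmDiff_right_comm J]
      have h1 := card_symmDiff_singleton (J ∆ K) i
      have h2 := card_symmDiff_singleton (J ∆ K ∆ {i}) k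
      omega
  have hKc : Kᶜ ∆ K = Finset.univ := compl_symmDiff_self K
  rw [Nat.even_iff] at hK
  rcases Nat.even_or_odd n with hn | hn
  · rw [Nat.even_iff] at hn
    refine ⟨Kᶜ, Nat.even_iff.2 (by omega), hle _ ?_⟩
    rw [hKc, Finset.card_univ, Fintype.card_fin]
    omega
  · rw [Nat.odd_iff] at hn
    refine ⟨Kᶜ ∆ {⟨0, by omega⟩}, ?_, hle _ ?_⟩
    · rw [Nat.even_iff]
      have := card_symmDiff_singleton Kᶜ ⟨0, by omega⟩
      omega
    · rw [symmDiff_right_comm, hKc]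
      have := card_symmDiff_singleton (Finset.univ : Finset (Fin n)) ⟨0, by omega⟩
      rw [Finset.card_univ, Fintype.card_fin] at this
      omega

theorem projectionIsBirational_spinorVariety {s : ℕ} (hs : s + 2 ≤ n / 2)
    {p : ℙ ℂ (EvenSubset n → ℂ)}
    {T : Submodule ℂ (EvenSubset n → ℂ)} (hT : IsOsculatingSpace (spinorVariety n) p s T) :
    ProjectionIsBirational ⊤ (spinorVariety n) T := by
  obtain ⟨⟨K, hKeven⟩, hK⟩ : ∃ K, p.rep K ≠ 0 := Function.ne_iff.1 p.rep_nonzero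
  obtain ⟨g, hg, hgK, hg2⟩ := exists_normalizing_symmetry K _ (ofHalfSpinLin p.rep)
    (by rwa [ofHalfSpinLin_coe p.rep ⟨K, hKeven⟩]) rfl
  obtain ⟨J, hJeven, hJ⟩ := exists_far_index hs hKeven
  have hXpure (x : EvenSubset n → ℂ) (h : x ≠ 0)
      (hx : Projectivization.mk ℂ x h ∈ spinorVariety n) : IsPure (g (ofHalfSpinLin x)) :=
    hg.isPure _ (isPure_of_mem_spinorVariety h hx)
  let coord (H : Finset (Fin n)) : (EvenSubset n → ℂ) →ₗ[ℂ] ℂ :=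
    LinearMap.proj H ∘ₗ g.toLinearMap ∘ₗ ofHalfSpinLin
  have hcoord (H x) : coord H x = g (ofHalfSpinLin x) H := rfl
  choose P hPhom hP using fun K' => exists_recovery_polynomial J _ K' rfl
  have hle (K' : Finset (Fin n)) : (K' ∆ J).card / 2 ≤ n := by
    have := Finset.card_le_univ (K' ∆ J)
    rw [Fintype.card_fin] at this
    omega
  refine ProjectionIsBirational.of_recovery le_top (fun _ _ => Submodule.mem_top)
    -- The recovered coordinates are brought to the common degree `n` by powers of the coordinate at
    -- `J`, then carried back by the inverse symmetry.
    (fun o => coord (chartCoord J o)) (fun o => ?_) none ?_ n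
    (fun H => ∑ K', MvPolynomial.C (g.symm (Pi.single K' 1) H) *
      (MvPolynomial.X none ^ (n - (K' ∆ J).card / 2) * P K')) (fun H => ?_) ?_
  · refine hT.le_ker _ fun m φ hφ hφX hφ0 => ?_
    obtain ⟨h0, hφ0⟩ := hφ0
    obtain ⟨c, hc, hrep⟩ := rep_eq_smul h0 hφ0
    rw [hrep, map_smul, map_smul] at hgK hg2
    refine (vanishesToOrder_of_isPure (χ := fun t => g (ofHalfSpinLin (φ t))) (K := K)
      (fun H => ?_) ?_ (fun h => hgK ?_) (fun H hH => ?_) _ (chartCoord J o) rfl).mono (hJ o)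
    · exact ((LinearMap.toContinuousLinearMap (coord H)).analyticAt _).comp hφ
    · filter_upwards [hφX] with t ht
      obtain ⟨h, ht⟩ := ht
      exact hXpure _ h ht
    · rw [Pi.smul_apply, h, smul_zero]
    · exact (smul_eq_zero.1 (hg2 H hH)).resolve_left hc
  -- The form `coord J` is not identically zero: the preimage under `g` of the coordinate spinor at
  -- `J` is again even, hence comes from the half-spin space.
  · have heven : IsEvenSpinor (Pi.single J 1 : Finset (Fin n) → ℂ) := by
      intro H hH
      rw [Pi.single_eq_of_ne]
      rintro rfl
      exact hH hJeven
    obtain ⟨x, hx⟩ := (hg.isEvenSpinor_symm _ heven).exists_ofHalfSpinLin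
    have hx1 : coord J x = 1 := by
      rw [hcoord, hx, LinearEquiv.apply_symm_apply, Pi.single_eq_same]
    obtain ⟨H, hH⟩ : ∃ H : EvenSubset n, coord J (Pi.single H 1) ≠ 0 := by
      by_contra! hall
      have h0 : coord J = 0 := by
        refine LinearMap.pi_ext' fun H => LinearMap.ext_ring ?_
        exact hall H
      rw [h0] at hx1
      simp at hx1
    obtain ⟨hne, hmem⟩ := single_mem_spinorVariety H
    refine ⟨_, hmem, ?_⟩
    obtain ⟨c, hc, hrep⟩ := rep_eq_smul hne rfl
    rw [hrep, map_smul]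
    exact smul_ne_zero hc hH
  · refine MvPolynomial.IsHomogeneous.sum _ _ _ fun K' _ => ?_
    refine MvPolynomial.IsHomogeneous.C_mul ?_ _
    have h := (MvPolynomial.isHomogeneous_X_pow (R := ℂ) (none : Option (Fin n × Fin n))
      (n - (K' ∆ J).card / 2)).mul (hPhom K')
    rwa [Nat.sub_add_cancel (hle K')] at h
  · intro q hq hq0
    have hpure := hXpure q.rep q.rep_nonzero (by rwa [q.mk_rep])
    set ψ := g (ofHalfSpinLin q.rep) with hψ
    have hψJ : ψ J ≠ 0 := hq0
    refine ⟨ψ J ^ n / ψ J, div_ne_zero (pow_ne_zero n hψJ) hψJ, fun H => ?_⟩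
    have hterm (K' : Finset (Fin n)) : ψ J ^ (n - (K' ∆ J).card / 2) *
        MvPolynomial.eval (fun o => ψ (chartCoord J o)) (P K') = ψ J ^ n / ψ J * ψ K' := by
      have h := hP K' ψ hpure hψJ
      have hpow := pow_sub_mul_pow (ψ J) (hle K')
      rw [div_mul_eq_mul_div, eq_div_iff hψJ]
      linear_combination ψ J ^ (n - (K' ∆ J).card / 2) * h + ψ K' * hpow
    have hinv : q.rep H = ∑ K', ψ K' * g.symm (Pi.single K' 1) H := by
      have h1 : ofHalfSpinLin q.rep = g.symm ψ := (g.symm_apply_apply _).symm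
      have h2 : ψ = ∑ K', ψ K' • (Pi.single K' 1 : Finset (Fin n) → ℂ) := by
        ext K'
        simp [Finset.sum_apply, Pi.single_apply]
      rw [← ofHalfSpinLin_coe q.rep H, h1]
      conv_lhs => rw [h2]
      simp [map_sum, Finset.sum_apply]
    rw [hinv, Finset.mul_sum, map_sum]
    refine Finset.sum_congr rfl fun K' _ => ?_
    simp only [map_mul, map_pow, MvPolynomial.eval_C, MvPolynomial.eval_X]
    have h := hterm K'
    simp only [hcoord, ← hψ]
    simp only [chartCoord, Option.elim] at h ⊢
    rw [h]
    ring

end SpinorProjections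

end OscProj

end

theorem mainTheorem7 (n s : ℕ) :
    (s + 2 ≤ n →
      ∀ p ∈ OscProj.lagrangianGrassmannian n,
        ∀ T : Submodule ℂ (OscProj.PluckerIndex n → ℂ),
          OscProj.IsOsculatingSpace (OscProj.lagrangianGrassmannian n) p s T →
          OscProj.ProjectionIsBirational (OscProj.linearSpan (OscProj.lagrangianGrassmannian n))
            (OscProj.lagrangianGrassmannian n) T) ∧
    (s + 2 ≤ 2 * (n / 2) →
      ∀ p ∈ OscProj.spinorPlucker n,
        ∀ T : Submodule ℂ (OscProj.PluckerIndex n → ℂ),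
          OscProj.IsOsculatingSpace (OscProj.spinorPlucker n) p s T →
          OscProj.ProjectionIsBirational (OscProj.linearSpan (OscProj.spinorPlucker n))
            (OscProj.spinorPlucker n) T) ∧
    (s + 2 ≤ n / 2 →
      ∀ p ∈ OscProj.spinorVariety n,
        ∀ T : Submodule ℂ (OscProj.EvenSubset n → ℂ),
          OscProj.IsOsculatingSpace (OscProj.spinorVariety n) p s T →
          OscProj.ProjectionIsBirational ⊤ (OscProj.spinorVariety n) T) := by
  exact ⟨fun hs _ hp _ hT => OscProj.projectionIsBirational_lagrangianGrassmannian hs hp hT,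
    fun hs _ hp _ hT => OscProj.projectionIsBirational_spinorPlucker hs hp hT,
    fun hs _ _ _ hT => OscProj.projectionIsBirational_spinorVariety hs hT⟩
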